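/- Let $H$ be a real separable infinite-dimensional Hilbert space and $\mathcal P(H)$ the set of Borel probability measures on $H$. For $P\in\mathcal P(H)$ let $\phi_P(w)=\int_H e^{i\langle x,w\rangle}\,P(dx)$. Let $\mathcal V$ be the set of all $\nu\in\mathcal P(H)$ that are symmetric ($\nu(A)=\nu(-A)$ for every Borel set $A$) and have support $H$. For $\nu\in\mathcal V$ and $\rho>0$ let $$\mathcal F_\nu(\rho)=\Big\{(P,Q)\in\mathcal P(H)^2:\int_H|\phi_P-\phi_Q|^2\,d\nu\ge\rho\Big\}.$$ Let $n_1,n_2\ge 1$ and let $X_1,\dots,X_{n_1}\sim P$ and $Y_1,\dots,Y_{n_2}\sim Q$ be independent; write $(Z_1,\dots,Z_{n_1+n_2})=(X_1,\dots,X_{n_1},Y_1,\dots,Y_{n_2})$. Let $\Pi_1,\dots,\Pi_B$ be i.i.d. uniform random permutations of $\{1,\dots,n_1+n_2\}$, independent of the data. For a permutation $\pi$ put $$T_\nu(\pi)=\int_H\Big|\frac1{n_1}\sum_{j=1}^{n_1}e^{i\langle Z_{\pi(j)},w\rangle}-\frac1{n_2}\sum_{k=1}^{n_2}e^{i\langle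 Z_{\pi(n_1+k)},w\rangle}\Big|^2\nu(dw).$$ Thus $T_\nu(\mathrm{id})$ is the squared empirical energy distance of the two samples. The permutation test of nominal level $\alpha$ is $$\hat\psi_\nu(\alpha)=\mathbb 1\Big\{\frac1B\sum_{b=1}^B\mathbb 1\{T_\nu(\Pi_b)<T_\nu(\mathrm{id})\}>1-\alpha\Big\}.$$ A test is a measurable $\{0,1\}$-valued function of the data and of $\Pi_1,\dots,\Pi_B$ (for $B=0$: of the data alone). Let $\Psi(\alpha)$ be the set of all tests $\psi$ with $\mathbb P(\psi=1)\le\alpha$ whenever $P=Q\in\mathcal P(H)$. For a test $\psi$, or for a family of tests indexed by $\nu\in\mathcal V$ such as $\hat\psi_\nu(\alpha)$, the uniform separation rate is $$\rho(\psi,\beta)=\inf\Big\{\rho>0:\sup_{\nu\in\mathcal V}\ \sup_{(P,Q)\in\mathcal F_\nu(\rho)}\mathbb P(\psi=0)\le\beta\Big\}$$ (with $\psi=\psi_\nu$ inside the supremum in the case of a family; the supremum over an empty set is $0$). The minimax separation rate is $\rho^*(\alpha,\beta)=\inf_{\psi\in\Psi(\alpha)}\rho(\psi,\beta)$, the infimum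 being over single tests $\psi$, which do not depend on $\nu$. **Theorem.** (i) For all $c_1,c_2>0$ there is a constant $c>0$, depending only on $c_1,c_2$, such that for all $n_1,n_2\ge1$ with $c_1\le n_1/n_2\le c_2$, all $\alpha,\beta>0$ with $\alpha+\beta<1$ and $\beta<1/e$, and all integers $B\ge 2\alpha^{-2}\log(6/\beta)$, $$\rho(\hat\psi_\nu(\alpha),\beta)\le c\,(n_1+n_2)^{-1/2}\{\log(\alpha^{-1})+\log(\beta^{-1})\}.$$ (ii) There is an absolute constant $c'>0$ such that for all $n_1,n_2\ge1$, all $B\ge0$ and all $\alpha,\beta>0$ with $\alpha+\beta<1$, $$\rho^*(\alpha,\beta)\ge c'\,(n_1+n_2)^{-1/2}.$$ -/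

import Mathlib

open MeasureTheory ProbabilityTheory
open scoped ENNReal

noncomputable section

namespace EnergyTest

variable {H : Type*} [NormedAddCommGroup H] [InnerProductSpace ℝ H] [MeasurableSpace H]

/-- Reference probability measures on `H`: symmetric, with full support. -/
def referenceMeasures (H : Type*) [NormedAddCommGroup H] [MeasurableSpace H] :
    Set (ProbabilityMeasure H) :=
  {ν | (∀ A : Set H, MeasurableSet A → (ν : Measure H) (-A) = (ν : Measure H) A) ∧
    (ν : Measure H).support = Set.univ}

/-- The squared energy distance `∫ |φ_P - φ_Q|² dν` (`charFun` is the characteristic functional). -/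
def energyDistSq (ν P Q : ProbabilityMeasure H) : ℝ :=
  ∫ w, ‖charFun (P : Measure H) w - charFun (Q : Measure H) w‖ ^ 2 ∂(ν : Measure H)

/-- The local alternatives: pairs of laws whose squared energy distance is at least `ρ`. -/
def localAlternatives (ν : ProbabilityMeasure H) (ρ : ℝ) :
    Set (ProbabilityMeasure H × ProbabilityMeasure H) :=
  {p | ρ ≤ energyDistSq ν p.1 p.2}

/-- The empirical characteristic functional of a sample of size `n`. -/
def empCharFun {n : ℕ} (x : Fin n → H) (w : H) : ℂ :=
  (n : ℂ)⁻¹ * ∑ j, Complex.exp ((inner ℝ (x j) w : ℝ) * Complex.I)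

/-- The squared empirical energy distance between the first `n₁` and the last `n₂` points of a
pooled sample `z`. -/
def empEnergyDistSq {n₁ n₂ : ℕ} (ν : ProbabilityMeasure H) (z : Fin n₁ ⊕ Fin n₂ → H) : ℝ :=
  ∫ w, ‖empCharFun (fun j => z (Sum.inl j)) w - empCharFun (fun k => z (Sum.inr k)) w‖ ^ 2
    ∂(ν : Measure H)

/-- Permutations of the `n₁ + n₂` indices of the pooled sample. -/
abbrev PoolPerm (n₁ n₂ : ℕ) : Type := Equiv.Perm (Fin n₁ ⊕ Fin n₂)

instance (n₁ n₂ : ℕ) : MeasurableSpace (PoolPerm n₁ n₂) := ⊤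

/-- What a test sees: the two samples, and `B` random permutations of the pooled index set. -/
abbrev Observation (H : Type*) (n₁ n₂ B : ℕ) : Type _ :=
  ((Fin n₁ → H) × (Fin n₂ → H)) × (Fin B → PoolPerm n₁ n₂)

/-- The law of the observation: `n₁` i.i.d. draws from `P`, `n₂` i.i.d. draws from `Q` and `B`
i.i.d. uniform permutations, all independent. -/
def observationLaw (n₁ n₂ B : ℕ) (P Q : ProbabilityMeasure H) :
    Measure (Observation H n₁ n₂ B) :=
  ((Measure.pi fun _ : Fin n₁ => (P : Measure H)).prod
    (Measure.pi fun _ : Fin n₂ => (Q : Measure H))).prod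
      (Measure.pi fun _ : Fin B => uniformOn (Set.univ : Set (PoolPerm n₁ n₂)))

/-- The rejection region `{ψ = 1}` of the permutation test of nominal level `α`: the proportion of
permutations whose permuted statistic is strictly below the observed statistic exceeds `1 - α`. -/
def permutationTest (n₁ n₂ B : ℕ) (α : ℝ) (ν : ProbabilityMeasure H) :
    Set (Observation H n₁ n₂ B) :=
  {o | 1 - α < (B : ℝ)⁻¹ * ∑ b : Fin B,
    Set.indicator
      {π : PoolPerm n₁ n₂ | empEnergyDistSq ν (Sum.elim o.1.1 o.1.2 ∘ π) <
        empEnergyDistSq ν (Sum.elim o.1.1 o.1.2)}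
      (fun _ => (1 : ℝ)) (o.2 b)}

/-- The (rejection regions of) tests whose type I error is at most `α` uniformly over the null
hypothesis that the two samples have the same law. -/
def levelTests (H : Type*) [NormedAddCommGroup H] [InnerProductSpace ℝ H] [MeasurableSpace H]
    (n₁ n₂ B : ℕ) (α : ℝ) : Set (Set (Observation H n₁ n₂ B)) :=
  {ψ | MeasurableSet ψ ∧
    (⨆ P : ProbabilityMeasure H, observationLaw n₁ n₂ B P P ψ) ≤ ENNReal.ofReal α}

/-- The uniform separation rate of `ψ`, given by its rejection region, which may depend on `ν`;
`(ψ ν)ᶜ` is the event of acceptance. -/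
def separationRate {n₁ n₂ B : ℕ} (ψ : ProbabilityMeasure H → Set (Observation H n₁ n₂ B))
    (β : ℝ) : ℝ :=
  sInf {ρ : ℝ | 0 < ρ ∧
    (⨆ ν ∈ referenceMeasures H, ⨆ p ∈ localAlternatives ν ρ,
      observationLaw n₁ n₂ B p.1 p.2 (ψ ν)ᶜ) ≤ ENNReal.ofReal β}

/-- The minimax separation rate over the tests of level `α`. -/
def minimaxRate (H : Type*) [NormedAddCommGroup H] [InnerProductSpace ℝ H] [MeasurableSpace H]
    (n₁ n₂ B : ℕ) (α β : ℝ) : ℝ :=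
  sInf ((fun ψ : Set (Observation H n₁ n₂ B) => separationRate (fun _ => ψ) β) ''
    levelTests H n₁ n₂ B α)

end EnergyTest

end

/-! Upper bound. Let `D` be the squared energy distance, `g = φ_P - φ_Q`, `u` the difference of the
empirical characteristic functionals, and `n = n₁ + n₂`. From `Re (u ḡ) ≤ |u|² + |g|²/4`, the
observed statistic is at least `L - D/4`, where `L` is the difference of the two sample means of one
bounded function, `witness`. The mean of `L` is `D`, so by Hoeffding `L > D/2` with high
probability, and then the statistic exceeds `D/4` (`mean_witness_sub_le_empEnergyDistSq`,
`mean_witness_sub_le_le`).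

A permuted statistic is rarely that large, whatever the pooled sample. For fixed `w` the real and
imaginary parts of the permuted `u` are linear permutation statistics with weights summing to zero.
They concentrate at scale `n^(-1/2)` by a martingale-type induction over the symmetric group
(`sum_perm_exp_le`), and Jensen's inequality integrates the bound over `ν`. Using `|u| ≤ 2` to
replace `|u|²` by a multiple of `|Re u| + |Im u|` is crude but suffices for this rate. A second use
of Hoeffding handles the `B` sampled permutations (`observationLaw_accept_le`).

Lower bound. It holds with the constant `1/4` in place of `n^(-1/2)`, because the test must serve
all `ν` at once in infinite dimension. Let `P` be the law of a random sign vector on `N` orthonormal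
directions and `Q_i` be `P` conditioned on the `i`-th sign being `+1`. Replacing `P` by `Q_i` in the
second sample conditions on an event of probability `2^(-n₂)`, and these events are pairwise
independent. For `N` large the acceptance event is almost uncorrelated, or positively correlated,
with one of them (`exists_mul_sub_le_measureReal_inter`), so acceptance under `(P, Q_i)` is nearly
as likely as under `(P, P)`. A `ν` with an atom where `φ_P` and `φ_{Q_i}` differ by `1` makes the
energy distance large. -/

namespace EnergyTest

/-! ### Concentration for functions of a uniform random permutation -/

/-- Hoeffding's lemma by symmetrization: Jensen replaces the mean by an independent copy, symmetry
turns `exp (g i - g j)` into `cosh`, and `cosh x ≤ exp (x² / 2)`. -/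
lemma sum_exp_le_card_mul_exp {ι : Type*} [Fintype ι] [Nonempty ι] (g : ι → ℝ) {R : ℝ}
    (h : ∀ i j, |g i - g j| ≤ R) :
    ∑ i, Real.exp (g i) ≤
      Fintype.card ι * Real.exp ((Fintype.card ι : ℝ)⁻¹ * ∑ i, g i + R ^ 2 / 2) := by
  set N : ℝ := (Fintype.card ι : ℝ) with hN
  have hN0 : 0 < N := by rw [hN]; exact_mod_cast Fintype.card_pos
  have hR : 0 ≤ R := (abs_nonneg _).trans (h (Classical.arbitrary ι) (Classical.arbitrary ι))
  have jensen : Real.exp (-(N⁻¹ * ∑ i, g i)) ≤ N⁻¹ * ∑ j, Real.exp (-g j) := by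
    have := convexOn_exp.map_sum_le (t := Finset.univ) (w := fun _ : ι => N⁻¹)
      (p := fun j => -g j) (fun _ _ => by positivity)
      (by simp [← hN, hN0.ne']) (fun _ _ => Set.mem_univ _)
    simpa [← Finset.mul_sum, Finset.sum_neg_distrib] using this
  have pair : ∑ i, ∑ j, Real.exp (g i - g j) ≤ N * (N * Real.exp (R ^ 2 / 2)) := by
    have hswap : ∑ i, ∑ j, Real.exp (g i - g j) = ∑ i, ∑ j, Real.cosh (g i - g j) := by
      have h2 : ∑ i, ∑ j, Real.exp (g i - g j) = ∑ i, ∑ j, Real.exp (g j - g i) :=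
        Finset.sum_comm
      have h3 : ∑ i, ∑ j, Real.cosh (g i - g j) =
          (∑ i, ∑ j, Real.exp (g i - g j) + ∑ i, ∑ j, Real.exp (g j - g i)) / 2 := by
        simp only [Real.cosh_eq, neg_sub, ← Finset.sum_div, Finset.sum_add_distrib]
      rw [h3, ← h2]; ring
    rw [hswap]
    have : ∀ i j, Real.cosh (g i - g j) ≤ Real.exp (R ^ 2 / 2) := fun i j => by
      refine (Real.cosh_le_exp_half_sq _).trans (Real.exp_le_exp.2 ?_)
      have := sq_le_sq' (by linarith [abs_le.1 (h i j)]) (abs_le.1 (h i j)).2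
      linarith
    calc _ ≤ ∑ _i : ι, ∑ _j : ι, Real.exp (R ^ 2 / 2) :=
          Finset.sum_le_sum fun i _ => Finset.sum_le_sum fun j _ => this i j
      _ = _ := by simp [← hN]
  have key : (∑ i, Real.exp (g i)) * Real.exp (-(N⁻¹ * ∑ i, g i)) ≤ N * Real.exp (R ^ 2 / 2) := by
    calc _ ≤ (∑ i, Real.exp (g i)) * (N⁻¹ * ∑ j, Real.exp (-g j)) := by
          gcongr
      _ = N⁻¹ * ∑ i, ∑ j, Real.exp (g i - g j) := by
          simp only [sub_eq_add_neg, Real.exp_add, ← Finset.mul_sum, ← Finset.sum_mul]; ring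
      _ ≤ N⁻¹ * (N * (N * Real.exp (R ^ 2 / 2))) := by gcongr
      _ = _ := by field_simp
  rw [Real.exp_neg, ← div_eq_mul_inv, div_le_iff₀ (Real.exp_pos _)] at key
  rw [Real.exp_add]
  linarith

/-- A concentration inequality for functions of a uniform random permutation that change by at most
`c` when two values are swapped. -/
theorem sum_perm_exp_le (α : Type*) [Fintype α] :
    ∀ [DecidableEq α] (f : Equiv.Perm α → ℝ) (c : ℝ), (∀ i j π, |f (Equiv.swap i j * π) - f π| ≤ c) →
    ∑ π, Real.exp (f π) ≤ Fintype.card (Equiv.Perm α) *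
      Real.exp ((Fintype.card (Equiv.Perm α) : ℝ)⁻¹ * ∑ π, f π +
        Fintype.card α * (c ^ 2 / 2)) := by
  refine Fintype.induction_empty_option (P := fun α _ =>
    ∀ [DecidableEq α] (f : Equiv.Perm α → ℝ) (c : ℝ), (∀ i j π, |f (Equiv.swap i j * π) - f π| ≤ c) →
    ∑ π, Real.exp (f π) ≤ Fintype.card (Equiv.Perm α) *
      Real.exp ((Fintype.card (Equiv.Perm α) : ℝ)⁻¹ * ∑ π, f π +
        Fintype.card α * (c ^ 2 / 2))) ?_ ?_ ?_ α
  · intro α β _ e ih _ f c hf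
    let _ := Fintype.ofEquiv β e.symm
    let _ : DecidableEq α := e.decidableEq
    have := ih (fun π => f (e.permCongr π)) c (fun i j π => by
      have h : e.permCongr (Equiv.swap i j * π) = Equiv.swap (e i) (e j) * e.permCongr π := by
        ext x
        simp only [Equiv.permCongr_apply, Equiv.Perm.mul_apply, Equiv.swap_apply_def,
          e.apply_eq_iff_eq]
        split_ifs <;> rfl
      rw [h]
      exact hf _ _ _)
    rw [Equiv.sum_comp e.permCongr (fun π => Real.exp (f π)), Equiv.sum_comp e.permCongr f,
      Fintype.card_congr e.permCongr, Fintype.card_congr e] at this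
    convert this
  · intro _ f c _
    simp
  · intro α _ ih inst f c hf
    classical
    obtain rfl : inst = Option.instDecidableEq := Subsingleton.elim _ _
    set N : ℝ := (Fintype.card (Equiv.Perm α) : ℝ) with hN
    have hN0 : 0 < N := by rw [hN]; exact_mod_cast Fintype.card_pos
    -- Condition on the image `i` of `none`. The inductive hypothesis controls each `F i` around its
    -- conditional mean `m i`, and Hoeffding's lemma then controls `m`.
    set F : Option α → Equiv.Perm α → ℝ :=
      fun i σ => f (Equiv.Perm.decomposeOption.symm (i, σ)) with hF
    have hFe : ∀ i σ, F i σ = f (Equiv.swap none i * Equiv.optionCongr σ) := fun i σ => rfl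
    have hswap : ∀ (a b : α) (σ : Equiv.Perm α), Equiv.optionCongr (Equiv.swap a b * σ) =
        Equiv.swap (some a) (some b) * Equiv.optionCongr σ := fun a b σ => by
      rw [← Equiv.optionCongr_swap]
      ext x : 1
      cases x <;> rfl
    have hsum : ∀ G : Equiv.Perm (Option α) → ℝ,
        ∑ π, G π = ∑ i, ∑ σ, G (Equiv.Perm.decomposeOption.symm (i, σ)) := fun G => by
      rw [← Equiv.sum_comp Equiv.Perm.decomposeOption.symm, Fintype.sum_prod_type]
    set m : Option α → ℝ := fun i => N⁻¹ * ∑ σ, F i σ with hm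
    have hm1 : ∀ i, ∑ σ, Real.exp (F i σ) ≤
        N * Real.exp (m i + Fintype.card α * (c ^ 2 / 2)) := fun i => by
      refine ih (F i) c fun a b σ => ?_
      -- A conjugate of a transposition is a transposition, so `F i` inherits the bounded difference
      -- `c`.
      rw [hFe, hFe, hswap, ← mul_assoc, Equiv.mul_swap_eq_swap_mul, mul_assoc]
      exact hf _ _ _
    have hdiff : ∀ i j (τ : Equiv.Perm α), (∀ σ, |F i (τ * σ) - F j σ| ≤ c) →
        |m i - m j| ≤ c := fun i j τ h => by
      rw [hm]
      simp only
      rw [← Equiv.sum_comp (Equiv.mulLeft τ) (F i), ← mul_sub, ← Finset.sum_sub_distrib, abs_mul,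
        abs_of_pos (inv_pos.2 hN0)]
      calc _ ≤ N⁻¹ * ∑ _σ : Equiv.Perm α, c := by
            gcongr
            exact (Finset.abs_sum_le_sum_abs _ _).trans (Finset.sum_le_sum fun σ _ => h σ)
        _ = c := by simp [← hN, hN0.ne']
    -- Conditional means are compared through a coupling: a bijection `σ ↦ τ * σ` under which the
    -- two full permutations differ by one transposition.
    have hmm : ∀ i j, |m i - m j| ≤ c := by
      have h0 : ∀ b, |m b - m none| ≤ c := fun b => hdiff _ _ 1 fun σ => by
        simpa [hFe] using! hf none b (Equiv.optionCongr σ)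
      rintro (_ | a) (_ | b)
      · exact h0 _
      · rw [abs_sub_comm]; exact h0 _
      · exact h0 _
      · rw [abs_sub_comm]
        refine hdiff _ _ (Equiv.swap a b) fun σ => ?_
        have : Equiv.swap none (some b) * Equiv.swap (some a) (some b) =
            Equiv.swap (some a) (some b) * Equiv.swap none (some a) := by
          rw [Equiv.mul_swap_eq_swap_mul (Equiv.swap (some a) (some b))]
          simp [Equiv.swap_apply_def]
        rw [hFe, hFe, hswap, ← mul_assoc, this, mul_assoc]
        exact hf _ _ _
    have hcard : (Fintype.card (Equiv.Perm (Option α)) : ℝ) = Fintype.card (Option α) * N := by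
      rw [hN, ← Nat.cast_mul, ← Fintype.card_prod]
      exact_mod_cast Fintype.card_congr Equiv.Perm.decomposeOption
    have hO : (0 : ℝ) < Fintype.card (Option α) := by exact_mod_cast Fintype.card_pos
    have hmean : (Fintype.card (Option α) : ℝ)⁻¹ * ∑ i, m i =
        (Fintype.card (Equiv.Perm (Option α)) : ℝ)⁻¹ * ∑ π, f π := by
      rw [hsum f, hcard, hm, ← Finset.mul_sum, mul_inv, mul_assoc]
    have hlast := sum_exp_le_card_mul_exp m hmm
    rw [hmean] at hlast
    rw [hsum]
    generalize (Fintype.card (Equiv.Perm (Option α)) : ℝ)⁻¹ * ∑ π, f π = y at hlast ⊢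
    have hO' : (Fintype.card (Option α) : ℝ) * (c ^ 2 / 2) =
        Fintype.card α * (c ^ 2 / 2) + c ^ 2 / 2 := by
      rw [Fintype.card_option]; push_cast; ring
    calc _ ≤ ∑ i, N * Real.exp (m i + Fintype.card α * (c ^ 2 / 2)) :=
          Finset.sum_le_sum fun i _ => hm1 i
      _ = N * Real.exp (Fintype.card α * (c ^ 2 / 2)) * ∑ i, Real.exp (m i) := by
          simp only [Real.exp_add, Finset.mul_sum]
          exact Finset.sum_congr rfl fun i _ => by ring
      _ ≤ N * Real.exp (Fintype.card α * (c ^ 2 / 2)) * (Fintype.card (Option α) *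
            Real.exp (y + c ^ 2 / 2)) := mul_le_mul_of_nonneg_left hlast (by positivity)
      _ = _ := by
          rw [hcard, hO']
          simp only [Real.exp_add]
          ring

end EnergyTest

/-! ### Exponential moments of the permuted energy statistic -/

namespace EnergyTest

section PermutedSums

variable {α : Type*} [Fintype α] [DecidableEq α]

/-- With the permutation moved onto the coefficients, a transposition only exchanges two of them,
and the change factors as (difference of coefficients) × (difference of values). -/
lemma abs_sum_mul_swap_sub_le (a x : α → ℝ) {A : ℝ} (ha : ∀ i j, |a i - a j| ≤ A)
    (hx : ∀ i, |x i| ≤ 1) (i j : α) (π : Equiv.Perm α) :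
    |∑ k, a k * x ((Equiv.swap i j * π) k) - ∑ k, a k * x (π k)| ≤ 2 * A := by
  have hA : 0 ≤ A := (abs_nonneg _).trans (ha i i)
  by_cases hij : i = j
  · subst hij
    simp [hA]
  have reindex : ∀ τ : Equiv.Perm α,
      ∑ k, a k * x (τ k) = ∑ k, a (τ.symm k) * x k := fun τ => by
    rw [← Equiv.sum_comp τ (fun k => a (τ.symm k) * x k)]
    simp
  rw [reindex, reindex, ← Finset.sum_sub_distrib, Fintype.sum_eq_add i j hij]
  · have hi : (Equiv.swap i j * π).symm i = π.symm j := by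
      rw [Equiv.symm_apply_eq]; simp
    have hj : (Equiv.swap i j * π).symm j = π.symm i := by
      rw [Equiv.symm_apply_eq]; simp
    rw [hi, hj]
    calc _ = |(a (π.symm j) - a (π.symm i)) * (x i - x j)| := by congr 1; ring
      _ ≤ A * 2 := by
        rw [abs_mul]
        refine mul_le_mul (ha _ _) ?_ (abs_nonneg _) hA
        exact (abs_sub _ _).trans (by linarith [hx i, hx j])
      _ = _ := by ring
  · rintro k ⟨hki, hkj⟩
    have : (Equiv.swap i j * π).symm k = π.symm k := by
      rw [Equiv.symm_apply_eq]; simp [Equiv.swap_apply_of_ne_of_ne hki hkj]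
    rw [this, sub_self]

lemma sum_perm_sum_mul_eq_zero (a x : α → ℝ) (ha : ∑ i, a i = 0) :
    ∑ π : Equiv.Perm α, ∑ k, a k * x (π k) = 0 := by
  rw [Finset.sum_comm]
  rcases isEmpty_or_nonempty α with h | ⟨⟨k₀⟩⟩
  · simp
  have : ∀ k, ∑ π : Equiv.Perm α, x (π k) = ∑ π : Equiv.Perm α, x (π k₀) := fun k => by
    rw [← Equiv.sum_comp (Equiv.mulRight (Equiv.swap k k₀))]
    simp
  simp only [← Finset.mul_sum, this]
  rw [← Finset.sum_mul, ha, zero_mul]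

/-- Each transposition changes the sum by at most `2 * A`, and its mean over permutations is zero;
the factor `2` pays for `exp |y| ≤ exp y + exp (-y)`. -/
lemma sum_perm_exp_abs_linear_le (a x : α → ℝ) {A l : ℝ} (ha : ∀ i j, |a i - a j| ≤ A)
    (ha0 : ∑ i, a i = 0) (hx : ∀ i, |x i| ≤ 1) (hl : 0 ≤ l) :
    ∑ π : Equiv.Perm α, Real.exp (l * |∑ k, a k * x (π k)|) ≤
      2 * Fintype.card (Equiv.Perm α) * Real.exp (2 * Fintype.card α * (l * A) ^ 2) := by
  have main : ∀ m : ℝ, |m| = l → ∑ π : Equiv.Perm α, Real.exp (m * ∑ k, a k * x (π k)) ≤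
      Fintype.card (Equiv.Perm α) * Real.exp (2 * Fintype.card α * (l * A) ^ 2) := fun m hm => by
    have := sum_perm_exp_le α (fun π => m * ∑ k, a k * x (π k)) (l * (2 * A)) fun i j π => by
      rw [← mul_sub, abs_mul, hm]
      exact mul_le_mul_of_nonneg_left (abs_sum_mul_swap_sub_le a x ha hx i j π) hl
    rw [← Finset.mul_sum, sum_perm_sum_mul_eq_zero a x ha0] at this
    refine this.trans (le_of_eq ?_)
    congr 2
    ring
  calc _ ≤ ∑ π : Equiv.Perm α, (Real.exp (l * ∑ k, a k * x (π k)) +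
        Real.exp (-l * ∑ k, a k * x (π k))) := Finset.sum_le_sum fun π _ => by
        rcases abs_cases (∑ k, a k * x (π k)) with h | h <;> rw [h.1]
        · linarith [Real.exp_pos (-l * ∑ k, a k * x (π k))]
        · rw [mul_neg, ← neg_mul]
          linarith [Real.exp_pos (l * ∑ k, a k * x (π k))]
    _ ≤ _ := by
        rw [Finset.sum_add_distrib]
        linarith [main l (abs_of_nonneg hl), main (-l) (by rw [abs_neg, abs_of_nonneg hl])]

end PermutedSums

/-- Hoeffding's inequality for the number of visits of an i.i.d. sample to a set. -/
theorem pi_sum_indicator_ge_le {Ω : Type*} [MeasurableSpace Ω] (μ : Measure Ω)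
    [IsProbabilityMeasure μ] (B : ℕ) {S : Set Ω} (hS : MeasurableSet S) {q ε : ℝ}
    (hq : μ.real S ≤ q) (hε : 0 ≤ ε) :
    (Measure.pi fun _ : Fin B => μ).real
      {ω | B * (q + ε) ≤ ∑ b, S.indicator (fun _ => (1 : ℝ)) (ω b)} ≤
      Real.exp (-2 * B * ε ^ 2) := by
  -- For `B = 0` the right-hand side is `1`.
  rcases Nat.eq_zero_or_pos B with rfl | hB
  · simp
  set X : Fin B → Ω → ℝ := fun _ ω => S.indicator (fun _ => (1 : ℝ)) ω - μ.real S with hX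
  have hXm : Measurable (S.indicator (fun _ => (1 : ℝ))) := measurable_const.indicator hS
  have hsub : ∀ b, HasSubgaussianMGF (X b) ((‖(1 : ℝ) - 0‖₊ / 2) ^ 2) μ := fun b => by
    have := hasSubgaussianMGF_of_mem_Icc (μ := μ) (X := S.indicator (fun _ => (1 : ℝ)))
      (a := 0) (b := 1) hXm.aemeasurable (ae_of_all _ fun ω => by
        by_cases h : ω ∈ S <;> simp [h])
    simpa [hX, integral_indicator hS] using this
  have hind := iIndepFun_pi (μ := fun _ : Fin B => μ) (X := X)
    fun b => (hXm.sub_const _).aemeasurable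
  have := HasSubgaussianMGF.measure_sum_ge_le_of_iIndepFun hind (s := Finset.univ)
    (c := fun _ => (‖(1 : ℝ) - 0‖₊ / 2) ^ 2) (fun b _ =>
      HasSubgaussianMGF.of_map (X := X b) (Y := fun ω : Fin B → Ω => ω b)
        (measurable_pi_apply b).aemeasurable
        (by rw [(measurePreserving_eval (fun _ : Fin B => μ) b).map_eq]; exact hsub b))
    (ε := B * ε) (by positivity)
  refine (measureReal_mono fun ω hω => ?_).trans (this.trans (Real.exp_le_exp.2 (le_of_eq ?_)))
  · have hω' : B * (q + ε) ≤ ∑ b, S.indicator (fun _ => (1 : ℝ)) (ω b) := hω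
    have : (B : ℝ) * μ.real S ≤ B * q := by gcongr
    simp only [hX, Set.mem_ofPred_eq, Finset.sum_sub_distrib, Finset.sum_const, Finset.card_univ,
      Fintype.card_fin, nsmul_eq_mul]
    linarith
  · have : (B : ℝ) ≠ 0 := by positivity
    simp
    field_simp

variable {H : Type*} [NormedAddCommGroup H] [InnerProductSpace ℝ H]

lemma norm_empCharFun_le {n : ℕ} (x : Fin n → H) (w : H) : ‖empCharFun x w‖ ≤ 1 := by
  rw [empCharFun, norm_mul, norm_inv, Complex.norm_natCast]
  have h : ‖∑ j, Complex.exp ((inner ℝ (x j) w : ℝ) * Complex.I)‖ ≤ n :=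
    (norm_sum_le _ _).trans (by simp [Complex.norm_exp_ofReal_mul_I])
  calc _ ≤ (n : ℝ)⁻¹ * n := by gcongr
    _ ≤ 1 := inv_mul_le_one

lemma continuous_empCharFun {n : ℕ} (x : Fin n → H) : Continuous (empCharFun x) := by
  unfold empCharFun
  fun_prop

/-- The coefficients of the difference of the two empirical characteristic functionals. -/
noncomputable def poolWeight (n₁ n₂ : ℕ) : Fin n₁ ⊕ Fin n₂ → ℝ :=
  Sum.elim (fun _ => (n₁ : ℝ)⁻¹) (fun _ => -(n₂ : ℝ)⁻¹)

lemma sum_poolWeight {n₁ n₂ : ℕ} (h₁ : 1 ≤ n₁) (h₂ : 1 ≤ n₂) : ∑ i, poolWeight n₁ n₂ i = 0 := by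
  have : (n₁ : ℝ) ≠ 0 := by positivity
  have : (n₂ : ℝ) ≠ 0 := by positivity
  simp [poolWeight, *]

lemma abs_poolWeight_sub_le (n₁ n₂ : ℕ) (i j : Fin n₁ ⊕ Fin n₂) :
    |poolWeight n₁ n₂ i - poolWeight n₁ n₂ j| ≤ (n₁ : ℝ)⁻¹ + (n₂ : ℝ)⁻¹ := by
  have h₁ : 0 ≤ (n₁ : ℝ)⁻¹ := by positivity
  have h₂ : 0 ≤ (n₂ : ℝ)⁻¹ := by positivity
  rcases i with i | i <;> rcases j with j | j <;> simp only [poolWeight, Sum.elim_inl, Sum.elim_inr]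
  all_goals rw [abs_le]; constructor <;> linarith

lemma empCharFun_sub_eq {n₁ n₂ : ℕ} (z : Fin n₁ ⊕ Fin n₂ → H) (w : H) :
    empCharFun (fun j => z (Sum.inl j)) w - empCharFun (fun k => z (Sum.inr k)) w =
      ∑ i, (poolWeight n₁ n₂ i : ℂ) * Complex.exp ((inner ℝ (z i) w : ℝ) * Complex.I) := by
  simp [empCharFun, poolWeight, Fintype.sum_sum_type, Finset.mul_sum, sub_eq_add_neg]

/-- As `‖u‖ ≤ 2`, the square is at most `2 |Re u| + 2 |Im u|`, and both parts are linear permutation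
statistics. Splitting `exp (a + b) ≤ (exp (2a) + exp (2b)) / 2` avoids their joint law and produces
the `4 * s`. -/
lemma sum_perm_exp_normSq_le {n₁ n₂ : ℕ} (h₁ : 1 ≤ n₁) (h₂ : 1 ≤ n₂)
    (z : Fin n₁ ⊕ Fin n₂ → H) (w : H) {s : ℝ} (hs : 0 ≤ s) :
    ∑ π : PoolPerm n₁ n₂, Real.exp (s * ‖empCharFun (fun j => z (π (Sum.inl j))) w -
        empCharFun (fun k => z (π (Sum.inr k))) w‖ ^ 2) ≤
      2 * Fintype.card (PoolPerm n₁ n₂) *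
        Real.exp (2 * (n₁ + n₂) * (4 * s * ((n₁ : ℝ)⁻¹ + (n₂ : ℝ)⁻¹)) ^ 2) := by
  have hs4 : 0 ≤ 4 * s := by positivity
  have hC := sum_perm_exp_abs_linear_le (poolWeight n₁ n₂) (fun i => Real.cos (inner ℝ (z i) w))
    (abs_poolWeight_sub_le n₁ n₂) (sum_poolWeight h₁ h₂) (fun _ => Real.abs_cos_le_one _) hs4
  have hS := sum_perm_exp_abs_linear_le (poolWeight n₁ n₂) (fun i => Real.sin (inner ℝ (z i) w))
    (abs_poolWeight_sub_le n₁ n₂) (sum_poolWeight h₁ h₂) (fun _ => Real.abs_sin_le_one _) hs4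
  rw [Fintype.card_sum, Fintype.card_fin, Fintype.card_fin] at hC hS
  push_cast at hC hS
  refine (Finset.sum_le_sum (g := fun π : PoolPerm n₁ n₂ =>
    (Real.exp (4 * s * |∑ k, poolWeight n₁ n₂ k * Real.cos (inner ℝ (z (π k)) w)|) +
      Real.exp (4 * s * |∑ k, poolWeight n₁ n₂ k * Real.sin (inner ℝ (z (π k)) w)|)) / 2)
    fun π _ => ?_).trans (by rw [← Finset.sum_div, Finset.sum_add_distrib]; linarith)
  set u := empCharFun (fun j => z (π (Sum.inl j))) w - empCharFun (fun k => z (π (Sum.inr k))) w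
    with hu
  have hu2 : ‖u‖ ≤ 2 := (norm_sub_le _ _).trans
    (by linarith [norm_empCharFun_le (fun j => z (π (Sum.inl j))) w,
      norm_empCharFun_le (fun j => z (π (Sum.inr j))) w])
  have hsum := empCharFun_sub_eq (fun i => z (π i)) w
  rw [← hu] at hsum
  have hre : u.re = ∑ i, poolWeight n₁ n₂ i * Real.cos (inner ℝ (z (π i)) w) := by
    rw [hsum, Complex.re_sum]
    exact Finset.sum_congr rfl fun i _ => by
      rw [Complex.re_ofReal_mul, Complex.exp_ofReal_mul_I_re]
  have him : u.im = ∑ i, poolWeight n₁ n₂ i * Real.sin (inner ℝ (z (π i)) w) := by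
    rw [hsum, Complex.im_sum]
    exact Finset.sum_congr rfl fun i _ => by
      rw [Complex.im_ofReal_mul, Complex.exp_ofReal_mul_I_im]
  rw [← hre, ← him]
  have hsq : ‖u‖ ^ 2 ≤ 2 * |u.re| + 2 * |u.im| := by
    rw [Complex.sq_norm, Complex.normSq_apply, ← abs_mul_abs_self u.re, ← abs_mul_abs_self u.im]
    have hr := (Complex.abs_re_le_norm u).trans hu2
    have hi := (Complex.abs_im_le_norm u).trans hu2
    nlinarith [abs_nonneg u.re, abs_nonneg u.im]
  have hle : s * ‖u‖ ^ 2 ≤ 2 * s * |u.re| + 2 * s * |u.im| := by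
    nlinarith [mul_le_mul_of_nonneg_left hsq hs]
  refine (Real.exp_le_exp.2 hle).trans ?_
  rw [Real.exp_add, show 4 * s * |u.re| = 2 * s * |u.re| + 2 * s * |u.re| by ring,
    show 4 * s * |u.im| = 2 * s * |u.im| + 2 * s * |u.im| by ring, Real.exp_add, Real.exp_add]
  nlinarith [sq_nonneg (Real.exp (2 * s * |u.re|) - Real.exp (2 * s * |u.im|))]

lemma integrable_of_continuous_of_norm_le {X E : Type*} [TopologicalSpace X]
    [MeasurableSpace X] [OpensMeasurableSpace X] [SecondCountableTopology X]
    [NormedAddCommGroup E] (ν : ProbabilityMeasure X) {f : X → E} (hf : Continuous f) {C : ℝ} (hC : ∀ w, ‖f w‖ ≤ C) :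
    Integrable f (ν : Measure X) :=
  Integrable.of_bound hf.aestronglyMeasurable C (ae_of_all _ hC)

lemma norm_empCharFun_sub_sq_le {m n : ℕ} (x : Fin m → H) (y : Fin n → H) (w : H) :
    ‖empCharFun x w - empCharFun y w‖ ^ 2 ≤ 4 := by
  have := (norm_sub_le (empCharFun x w) (empCharFun y w)).trans
    (add_le_add (norm_empCharFun_le x w) (norm_empCharFun_le y w))
  nlinarith [norm_nonneg (empCharFun x w - empCharFun y w)]

variable [MeasurableSpace H] [BorelSpace H] [SecondCountableTopology H]

/-- Jensen moves the exponential inside the integral over `ν`; the pointwise bound is uniform in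
`w`. -/
theorem sum_perm_exp_empEnergyDistSq_le {n₁ n₂ : ℕ} (h₁ : 1 ≤ n₁) (h₂ : 1 ≤ n₂)
    (ν : ProbabilityMeasure H) (z : Fin n₁ ⊕ Fin n₂ → H) {s : ℝ} (hs : 0 ≤ s) :
    ∑ π : PoolPerm n₁ n₂, Real.exp (s * empEnergyDistSq ν (z ∘ π)) ≤
      2 * Fintype.card (PoolPerm n₁ n₂) *
        Real.exp (2 * (n₁ + n₂) * (4 * s * ((n₁ : ℝ)⁻¹ + (n₂ : ℝ)⁻¹)) ^ 2) := by
  set f : PoolPerm n₁ n₂ → H → ℝ := fun π w => s * ‖empCharFun (fun j => z (π (Sum.inl j))) w -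
        empCharFun (fun k => z (π (Sum.inr k))) w‖ ^ 2 with hf
  have hfc : ∀ π, Continuous (f π) := fun π =>
    continuous_const.mul
      (((continuous_empCharFun _).sub (continuous_empCharFun _)).norm.pow 2)
  have hf4 : ∀ π w, f π w ≤ s * 4 := fun π w =>
    mul_le_mul_of_nonneg_left (norm_empCharFun_sub_sq_le _ _ w) hs
  have hf0 : ∀ π w, 0 ≤ f π w := fun π w => by positivity
  have hfi : ∀ π, Integrable (f π) (ν : Measure H) := fun π =>
    integrable_of_continuous_of_norm_le ν (hfc π) (C := s * 4) fun w => by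
      rw [Real.norm_of_nonneg (hf0 π w)]; exact hf4 π w
  have hei : ∀ π, Integrable (fun w => Real.exp (f π w)) (ν : Measure H) := fun π =>
    integrable_of_continuous_of_norm_le ν (Real.continuous_exp.comp (hfc π))
      (C := Real.exp (s * 4)) fun w => by
      rw [Real.norm_of_nonneg (Real.exp_nonneg _)]; exact Real.exp_le_exp.2 (hf4 π w)
  calc _ ≤ ∑ π, ∫ w, Real.exp (f π w) ∂(ν : Measure H) := Finset.sum_le_sum fun π _ => by
        have h := convexOn_exp.map_integral_le (μ := (ν : Measure H)) (f := f π)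
          Real.continuous_exp.continuousOn isClosed_univ (by simp) (hfi π) (hei π)
        rwa [hf, integral_const_mul] at h
    _ = ∫ w, ∑ π, Real.exp (f π w) ∂(ν : Measure H) := by
        rw [integral_finsetSum _ fun π _ => hei π]
    _ ≤ ∫ _w, 2 * Fintype.card (PoolPerm n₁ n₂) *
        Real.exp (2 * (n₁ + n₂) * (4 * s * ((n₁ : ℝ)⁻¹ + (n₂ : ℝ)⁻¹)) ^ 2) ∂(ν : Measure H) :=
        integral_mono (integrable_finsetSum _ fun π _ => hei π) (integrable_const _)
          fun w => sum_perm_exp_normSq_le h₁ h₂ z w hs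
    _ = _ := by simp

/-- The proportion of permutations with a large permuted statistic is exponentially small. -/
theorem uniformOn_le_empEnergyDistSq_le {n₁ n₂ : ℕ} (h₁ : 1 ≤ n₁) (h₂ : 1 ≤ n₂)
    (ν : ProbabilityMeasure H) (z : Fin n₁ ⊕ Fin n₂ → H) {s : ℝ} (hs : 0 ≤ s) (t : ℝ) :
    (uniformOn (Set.univ : Set (PoolPerm n₁ n₂))).real {π | t ≤ empEnergyDistSq ν (z ∘ π)} ≤
      2 * Real.exp (2 * (n₁ + n₂) * (4 * s * ((n₁ : ℝ)⁻¹ + (n₂ : ℝ)⁻¹)) ^ 2 - s * t) := by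
  classical
  set S := {π : PoolPerm n₁ n₂ | t ≤ empEnergyDistSq ν (z ∘ π)} with hS
  have : MeasurableSingletonClass (PoolPerm n₁ n₂) := ⟨fun _ => trivial⟩
  have hN : (0 : ℝ) < Fintype.card (PoolPerm n₁ n₂) := by exact_mod_cast Fintype.card_pos
  have hreal : (uniformOn (Set.univ : Set (PoolPerm n₁ n₂))).real S =
      (Finset.univ.filter (· ∈ S)).card / Fintype.card (PoolPerm n₁ n₂) := by
    rw [Measure.real, uniformOn_univ, ENNReal.toReal_div, ENNReal.toReal_natCast]
    congr 1
    rw [Measure.count_apply_finite S S.toFinite, ENNReal.toReal_natCast, Nat.cast_inj]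
    congr 1
    ext
    simp only [Set.Finite.mem_toFinset, Finset.mem_filter, Finset.mem_univ, true_and]
  rw [hreal, div_le_iff₀ hN, Real.exp_sub]
  have := sum_perm_exp_empEnergyDistSq_le h₁ h₂ ν z hs
  -- Exponential Markov inequality for the counting measure.
  have hlow : (Finset.univ.filter (· ∈ S)).card * Real.exp (s * t) ≤
      ∑ π : PoolPerm n₁ n₂, Real.exp (s * empEnergyDistSq ν (z ∘ π)) := by
    calc _ = ∑ π ∈ Finset.univ.filter (· ∈ S), Real.exp (s * t) := by simp
      _ ≤ ∑ π ∈ Finset.univ.filter (· ∈ S), Real.exp (s * empEnergyDistSq ν (z ∘ π)) :=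
          Finset.sum_le_sum fun π hπ => Real.exp_le_exp.2
            (mul_le_mul_of_nonneg_left (Finset.mem_filter.1 hπ).2 hs)
      _ ≤ _ := Finset.sum_le_sum_of_subset_of_nonneg (Finset.filter_subset _ _)
          fun _ _ _ => Real.exp_nonneg _
  have h := hlow.trans this
  rw [← le_div_iff₀ (Real.exp_pos _)] at h
  refine h.trans (le_of_eq ?_)
  ring

end EnergyTest

/-! ### A linear lower bound for the observed statistic -/

namespace EnergyTest

/-- The empirical mean of a bounded function of an i.i.d. sample is sub-Gaussian. -/
theorem hasSubgaussianMGF_mean {Ω : Type*} [MeasurableSpace Ω] (μ : Measure Ω)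
    [IsProbabilityMeasure μ] {n : ℕ} (hn : 1 ≤ n) {h : Ω → ℝ} (hm : Measurable h) {C : NNReal}
    (hC : ∀ x, |h x| ≤ C) :
    HasSubgaussianMGF (fun x : Fin n → Ω => (n : ℝ)⁻¹ * ∑ j, h (x j) - ∫ x, h x ∂μ)
      (C ^ 2 / n) (Measure.pi fun _ : Fin n => μ) := by
  have hn0 : (n : ℝ) ≠ 0 := by positivity
  set X : Fin n → Ω → ℝ := fun _ x => h x - ∫ x, h x ∂μ with hX
  have hC2 : (‖(C : ℝ) - (-C)‖₊ / 2) ^ 2 = C ^ 2 := by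
    rw [← NNReal.coe_inj]
    push_cast
    rw [Real.norm_of_nonneg (by rw [sub_neg_eq_add]; positivity)]
    ring
  have hsub : ∀ b, HasSubgaussianMGF (X b) (C ^ 2) μ := fun b => hC2 ▸
    hasSubgaussianMGF_of_mem_Icc hm.aemeasurable (ae_of_all _ fun x => abs_le.1 (hC x))
  have hind := iIndepFun_pi (μ := fun _ : Fin n => μ) (X := X)
    fun b => (hm.sub_const _).aemeasurable
  have hsum := HasSubgaussianMGF.sum_of_iIndepFun hind (s := Finset.univ)
    (c := fun _ => C ^ 2) (fun b _ =>
      HasSubgaussianMGF.of_map (X := X b) (Y := fun ω : Fin n → Ω => ω b)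
        (measurable_pi_apply b).aemeasurable
        (by rw [(measurePreserving_eval (fun _ : Fin n => μ) b).map_eq]; exact hsub b))
  convert hsum.const_mul (n : ℝ)⁻¹ using 1
  · ext x
    simp only [hX, Finset.sum_sub_distrib, Finset.sum_const, Finset.card_univ, Fintype.card_fin,
      nsmul_eq_mul]
    field_simp
  · rw [← NNReal.coe_inj]
    change ((C ^ 2 / n : NNReal) : ℝ) = ((n : ℝ)⁻¹ ^ 2) * ((∑ _i : Fin n, C ^ 2 : NNReal) : ℝ)
    push_cast
    simp only [Finset.sum_const, Finset.card_univ, Fintype.card_fin, nsmul_eq_mul]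
    field_simp

variable {H : Type*} [NormedAddCommGroup H] [InnerProductSpace ℝ H] [MeasurableSpace H]

/-- The function of one observation whose mean difference under `P` and `Q` is the squared energy
distance. -/
noncomputable def witness (ν P Q : ProbabilityMeasure H) (x : H) : ℝ :=
  ∫ w, (Complex.exp ((inner ℝ x w : ℝ) * Complex.I) *
    (starRingEnd ℂ) (charFun (P : Measure H) w - charFun (Q : Measure H) w)).re ∂(ν : Measure H)

lemma norm_charFun_sub_le_two (P Q : ProbabilityMeasure H) (w : H) :
    ‖charFun (P : Measure H) w - charFun (Q : Measure H) w‖ ≤ 2 :=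
  (norm_sub_le _ _).trans
    (by linarith [norm_charFun_le_one (μ := (P : Measure H)) w,
      norm_charFun_le_one (μ := (Q : Measure H)) w])

lemma norm_exp_mul_conj_le_two (P Q : ProbabilityMeasure H) (x w : H) :
    ‖Complex.exp ((inner ℝ x w : ℝ) * Complex.I) *
      (starRingEnd ℂ) (charFun (P : Measure H) w - charFun (Q : Measure H) w)‖ ≤ 2 := by
  rw [norm_mul, Complex.norm_exp_ofReal_mul_I, one_mul, RCLike.norm_conj]
  exact norm_charFun_sub_le_two P Q w

lemma abs_witness_le_two (ν P Q : ProbabilityMeasure H) (x : H) : |witness ν P Q x| ≤ 2 := by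
  have := norm_integral_le_of_norm_le_const (μ := (ν : Measure H)) (C := 2)
    (f := fun w => (Complex.exp ((inner ℝ x w : ℝ) * Complex.I) *
      (starRingEnd ℂ) (charFun (P : Measure H) w - charFun (Q : Measure H) w)).re)
    (ae_of_all _ fun w => (Complex.abs_re_le_norm _).trans (norm_exp_mul_conj_le_two P Q x w))
  simpa [witness] using this

variable [BorelSpace H] [SecondCountableTopology H]

lemma measurable_exp_mul_conj (P Q : ProbabilityMeasure H) :
    Measurable fun p : H × H => Complex.exp ((inner ℝ p.1 p.2 : ℝ) * Complex.I) *
      (starRingEnd ℂ) (charFun (P : Measure H) p.2 - charFun (Q : Measure H) p.2) := by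
  have h1 : Measurable fun p : H × H => Complex.exp ((inner ℝ p.1 p.2 : ℝ) * Complex.I) := by
    fun_prop
  have h2 : Measurable fun w : H => charFun (P : Measure H) w - charFun (Q : Measure H) w :=
    measurable_charFun.sub measurable_charFun
  exact h1.mul ((continuous_star.measurable.comp h2).comp measurable_snd)

lemma measurable_witness (ν P Q : ProbabilityMeasure H) : Measurable (witness ν P Q) :=
  (Complex.measurable_re.comp
    (measurable_exp_mul_conj P Q)).stronglyMeasurable.integral_prod_right'.measurable

lemma integrable_exp_mul_conj (P Q : ProbabilityMeasure H) (ν : ProbabilityMeasure H) (x : H) :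
    Integrable (fun w => (Complex.exp ((inner ℝ x w : ℝ) * Complex.I) *
      (starRingEnd ℂ) (charFun (P : Measure H) w - charFun (Q : Measure H) w)).re)
      (ν : Measure H) :=
  Integrable.of_bound (Complex.measurable_re.comp ((measurable_exp_mul_conj P Q).comp
    measurable_prodMk_left)).aestronglyMeasurable 2
    (ae_of_all _ fun w => (Complex.abs_re_le_norm _).trans (norm_exp_mul_conj_le_two P Q x w))

lemma integral_witness (ν P Q R : ProbabilityMeasure H) :
    ∫ x, witness ν P Q x ∂(R : Measure H) =
      ∫ w, (charFun (R : Measure H) w * (starRingEnd ℂ)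
        (charFun (P : Measure H) w - charFun (Q : Measure H) w)).re ∂(ν : Measure H) := by
  unfold witness
  rw [integral_integral_swap]
  · refine integral_congr_ae (ae_of_all _ fun w => ?_)
    have hint : Integrable (fun x => Complex.exp ((inner ℝ x w : ℝ) * Complex.I) *
      (starRingEnd ℂ) (charFun (P : Measure H) w - charFun (Q : Measure H) w))
      (R : Measure H) :=
      Integrable.of_bound ((measurable_exp_mul_conj P Q).comp
        measurable_prodMk_right).aestronglyMeasurable 2
        (ae_of_all _ fun x => norm_exp_mul_conj_le_two P Q x w)
    have h := integral_re hint
    simp only [RCLike.re_eq_complex_re] at h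
    simp only
    rw [h, integral_mul_const, charFun_apply (μ := (R : Measure H))]
  · exact Integrable.of_bound (Complex.measurable_re.comp
      (measurable_exp_mul_conj P Q)).aestronglyMeasurable 2
      (ae_of_all _ fun p => (Complex.abs_re_le_norm _).trans
        (norm_exp_mul_conj_le_two P Q p.1 p.2))

lemma integrable_charFun_mul_conj_re (ν P Q R : ProbabilityMeasure H) :
    Integrable (fun w => (charFun (R : Measure H) w * (starRingEnd ℂ)
      (charFun (P : Measure H) w - charFun (Q : Measure H) w)).re) (ν : Measure H) := by
  refine Integrable.of_bound (Complex.measurable_re.comp (measurable_charFun.mul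
    (continuous_star.measurable.comp
      (measurable_charFun.sub measurable_charFun)))).aestronglyMeasurable 2
    (ae_of_all _ fun w => (Complex.abs_re_le_norm _).trans ?_)
  rw [norm_mul, RCLike.norm_conj]
  have h1 := norm_charFun_le_one (μ := (R : Measure H)) w
  nlinarith [norm_charFun_sub_le_two P Q w, norm_nonneg (charFun (R : Measure H) w)]

lemma integral_witness_sub (ν P Q : ProbabilityMeasure H) :
    ∫ x, witness ν P Q x ∂(P : Measure H) - ∫ x, witness ν P Q x ∂(Q : Measure H) =
      energyDistSq ν P Q := by
  rw [integral_witness, integral_witness,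
    ← integral_sub (integrable_charFun_mul_conj_re ν P Q P)
      (integrable_charFun_mul_conj_re ν P Q Q), energyDistSq]
  refine integral_congr_ae (ae_of_all _ fun w => ?_)
  simp only
  rw [← Complex.sub_re, ← sub_mul, Complex.mul_conj, Complex.ofReal_re, Complex.sq_norm]

/-- This trades the quadratic statistic for a linear one, leaving only means of i.i.d. bounded
variables to control. Integrate `Re (u ḡ) ≤ |u|² + |g|²/4`, a completed square. -/
lemma mean_witness_sub_le_empEnergyDistSq {n₁ n₂ : ℕ} (ν P Q : ProbabilityMeasure H)
    (z : Fin n₁ ⊕ Fin n₂ → H) :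
    (n₁ : ℝ)⁻¹ * ∑ j, witness ν P Q (z (Sum.inl j)) -
        (n₂ : ℝ)⁻¹ * ∑ k, witness ν P Q (z (Sum.inr k)) - energyDistSq ν P Q / 4 ≤
      empEnergyDistSq ν z := by
  set g : H → ℂ := fun w => charFun (P : Measure H) w - charFun (Q : Measure H) w with hg
  set u : H → ℂ := fun w => empCharFun (fun j => z (Sum.inl j)) w -
    empCharFun (fun k => z (Sum.inr k)) w with hu
  have hlin : (n₁ : ℝ)⁻¹ * ∑ j, witness ν P Q (z (Sum.inl j)) -
      (n₂ : ℝ)⁻¹ * ∑ k, witness ν P Q (z (Sum.inr k)) =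
      ∫ w, (u w * (starRingEnd ℂ) (g w)).re ∂(ν : Measure H) := by
    have h1 : ∀ w, (u w * (starRingEnd ℂ) (g w)).re = ∑ i, poolWeight n₁ n₂ i *
        (Complex.exp ((inner ℝ (z i) w : ℝ) * Complex.I) * (starRingEnd ℂ) (g w)).re := fun w => by
      rw [hu]
      simp only
      rw [empCharFun_sub_eq, Finset.sum_mul, Complex.re_sum]
      refine Finset.sum_congr rfl fun i _ => ?_
      rw [mul_assoc, Complex.re_ofReal_mul]
    simp only [h1]
    rw [integral_finsetSum _ fun i _ => (integrable_exp_mul_conj P Q ν (z i)).const_mul _]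
    simp only [integral_const_mul]
    simp [poolWeight, Fintype.sum_sum_type, witness, Finset.mul_sum, sub_eq_add_neg]
  have hgm : Measurable g := measurable_charFun.sub measurable_charFun
  have hum : Measurable u := ((continuous_empCharFun _).sub (continuous_empCharFun _)).measurable
  have hu2 : Integrable (fun w => ‖u w‖ ^ 2) (ν : Measure H) :=
    Integrable.of_bound (hum.norm.pow_const 2).aestronglyMeasurable 4 (ae_of_all _ fun w => by
      rw [Real.norm_of_nonneg (by positivity)]
      exact norm_empCharFun_sub_sq_le _ _ w)
  have hg2 : Integrable (fun w => ‖g w‖ ^ 2) (ν : Measure H) :=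
    Integrable.of_bound (hgm.norm.pow_const 2).aestronglyMeasurable 4 (ae_of_all _ fun w => by
      rw [Real.norm_of_nonneg (by positivity)]
      nlinarith [norm_charFun_sub_le_two P Q w, norm_nonneg (g w)])
  have hpt : ∀ w, (u w * (starRingEnd ℂ) (g w)).re ≤ ‖u w‖ ^ 2 + ‖g w‖ ^ 2 / 4 := fun w => by
    rw [Complex.sq_norm, Complex.sq_norm, Complex.normSq_apply, Complex.normSq_apply,
      Complex.mul_re, Complex.conj_re, Complex.conj_im]
    nlinarith [sq_nonneg ((u w).re - (g w).re / 2), sq_nonneg ((u w).im - (g w).im / 2)]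
  rw [hlin, sub_le_iff_le_add, energyDistSq, empEnergyDistSq, ← integral_div,
    ← integral_add hu2 (hg2.div_const 4)]
  refine integral_mono ?_ (hu2.add (hg2.div_const 4)) hpt
  refine Integrable.of_bound (Complex.measurable_re.comp
    (hum.mul (continuous_star.measurable.comp hgm))).aestronglyMeasurable 4
    (ae_of_all _ fun w => (Complex.abs_re_le_norm _).trans ?_)
  have h1 := norm_empCharFun_sub_sq_le (fun j => z (Sum.inl j)) (fun k => z (Sum.inr k)) w
  rw [norm_mul, RCLike.norm_conj]
  have h2 : ‖u w‖ ^ 2 ≤ 4 := h1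
  nlinarith [norm_charFun_sub_le_two P Q w, norm_nonneg (g w), norm_nonneg (u w)]

end EnergyTest

/-! ### Type II error of the permutation test -/

namespace EnergyTest

variable {H : Type*} [NormedAddCommGroup H] [InnerProductSpace ℝ H] [MeasurableSpace H]

/-- Acceptance leaves at least `B * α` permutations whose statistic is not strictly below the
observed one, hence at least `t`. -/
lemma accept_subset {n₁ n₂ B : ℕ} (hB : 1 ≤ B) (α t : ℝ) (ν : ProbabilityMeasure H)
    {o : Observation H n₁ n₂ B} (ho : o ∉ permutationTest n₁ n₂ B α ν)
    (ht : t ≤ empEnergyDistSq ν (Sum.elim o.1.1 o.1.2)) :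
    B * α ≤ ∑ b, Set.indicator {π : PoolPerm n₁ n₂ |
      t ≤ empEnergyDistSq ν (Sum.elim o.1.1 o.1.2 ∘ π)} (fun _ => (1 : ℝ)) (o.2 b) := by
  have hB0 : (0 : ℝ) < B := by exact_mod_cast hB
  have ho' : (B : ℝ)⁻¹ * ∑ b : Fin B, Set.indicator
      {π : PoolPerm n₁ n₂ | empEnergyDistSq ν (Sum.elim o.1.1 o.1.2 ∘ π) <
        empEnergyDistSq ν (Sum.elim o.1.1 o.1.2)} (fun _ => (1 : ℝ)) (o.2 b) ≤ 1 - α :=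
    not_lt.1 ho
  rw [inv_mul_le_iff₀ hB0] at ho'
  have hle : ∀ b : Fin B, 1 - Set.indicator
      {π : PoolPerm n₁ n₂ | empEnergyDistSq ν (Sum.elim o.1.1 o.1.2 ∘ π) <
        empEnergyDistSq ν (Sum.elim o.1.1 o.1.2)} (fun _ => (1 : ℝ)) (o.2 b) ≤
      Set.indicator {π : PoolPerm n₁ n₂ |
      t ≤ empEnergyDistSq ν (Sum.elim o.1.1 o.1.2 ∘ π)} (fun _ => (1 : ℝ)) (o.2 b) := fun b => by
    simp only [Set.indicator_apply, Set.mem_ofPred_eq]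
    split_ifs with h1 h2 h2
    · norm_num
    · norm_num
    · norm_num
    · exact absurd (ht.trans (not_lt.1 h1)) h2
  have hsum := Finset.sum_le_sum fun b (_ : b ∈ Finset.univ) => hle b
  rw [Finset.sum_sub_distrib] at hsum
  simp only [Finset.sum_const, Finset.card_univ, Fintype.card_fin, nsmul_eq_mul, mul_one] at hsum
  linarith

variable [BorelSpace H] [SecondCountableTopology H]

lemma measurable_empEnergyDistSq {n₁ n₂ : ℕ} (ν : ProbabilityMeasure H) (π : PoolPerm n₁ n₂) :
    Measurable fun d : (Fin n₁ → H) × (Fin n₂ → H) =>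
      empEnergyDistSq ν (Sum.elim d.1 d.2 ∘ π) := by
  have hcoord : ∀ i : Fin n₁ ⊕ Fin n₂,
      Continuous fun d : (Fin n₁ → H) × (Fin n₂ → H) => Sum.elim d.1 d.2 i := fun i => by
    rcases i with i | i <;> simp only [Sum.elim_inl, Sum.elim_inr] <;> fun_prop
  have hcoord' : ∀ i : Fin n₁ ⊕ Fin n₂,
      Continuous fun p : ((Fin n₁ → H) × (Fin n₂ → H)) × H => Sum.elim p.1.1 p.1.2 i :=
    fun i => (hcoord i).comp continuous_fst
  have hcont : Continuous fun p : ((Fin n₁ → H) × (Fin n₂ → H)) × H =>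
      ‖empCharFun (fun j => (Sum.elim p.1.1 p.1.2 ∘ π) (Sum.inl j)) p.2 -
        empCharFun (fun k => (Sum.elim p.1.1 p.1.2 ∘ π) (Sum.inr k)) p.2‖ ^ 2 := by
    unfold empCharFun
    simp only [Function.comp_apply]
    fun_prop
  exact hcont.measurable.stronglyMeasurable.integral_prod_right'.measurable

/-- The linear statistic has mean `D = energyDistSq ν P Q` and sub-Gaussian proxy `4 (1/n₁ + 1/n₂)`;
a downward deviation `D / 2` gives the exponent `D² / 32`, up to the factor `1/n₁ + 1/n₂`. -/
theorem mean_witness_sub_le_le {n₁ n₂ : ℕ} (h₁ : 1 ≤ n₁) (h₂ : 1 ≤ n₂)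
    (ν P Q : ProbabilityMeasure H) :
    ((Measure.pi fun _ : Fin n₁ => (P : Measure H)).prod
      (Measure.pi fun _ : Fin n₂ => (Q : Measure H))).real
      {d | (n₁ : ℝ)⁻¹ * ∑ j, witness ν P Q (d.1 j) - (n₂ : ℝ)⁻¹ * ∑ k, witness ν P Q (d.2 k) ≤
        energyDistSq ν P Q / 2} ≤
      Real.exp (-(energyDistSq ν P Q) ^ 2 / (32 * ((n₁ : ℝ)⁻¹ + (n₂ : ℝ)⁻¹))) := by
  have hm := measurable_witness ν P Q
  have hX := hasSubgaussianMGF_mean (P : Measure H) h₁ hm (C := 2) (abs_witness_le_two ν P Q)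
  have hY := hasSubgaussianMGF_mean (Q : Measure H) h₂ hm (C := 2) (abs_witness_le_two ν P Q)
  set μ₁ := Measure.pi fun _ : Fin n₁ => (P : Measure H)
  set μ₂ := Measure.pi fun _ : Fin n₂ => (Q : Measure H)
  set X : (Fin n₁ → H) → ℝ := fun x =>
    (n₁ : ℝ)⁻¹ * ∑ j, witness ν P Q (x j) - ∫ x, witness ν P Q x ∂(P : Measure H) with hXd
  set Y : (Fin n₂ → H) → ℝ := fun x =>
    (n₂ : ℝ)⁻¹ * ∑ j, witness ν P Q (x j) - ∫ x, witness ν P Q x ∂(Q : Measure H) with hYd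
  have hXm : Measurable X := by fun_prop
  have hYm : Measurable Y := by fun_prop
  have hind : IndepFun (fun d : (Fin n₁ → H) × (Fin n₂ → H) => X d.1) (fun d => Y d.2)
      (μ₁.prod μ₂) := indepFun_prod hXm hYm
  have hX' : HasSubgaussianMGF (fun d : (Fin n₁ → H) × (Fin n₂ → H) => X d.1) (2 ^ 2 / n₁)
      (μ₁.prod μ₂) := HasSubgaussianMGF.of_map (X := X) measurable_fst.aemeasurable
        (by rw [measurePreserving_fst.map_eq]; exact hX)
  have hY' : HasSubgaussianMGF (fun d : (Fin n₁ → H) × (Fin n₂ → H) => Y d.2) (2 ^ 2 / n₂)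
      (μ₁.prod μ₂) := HasSubgaussianMGF.of_map (X := Y) measurable_snd.aemeasurable
        (by rw [measurePreserving_snd.map_eq]; exact hY)
  have hD : 0 ≤ energyDistSq ν P Q := integral_nonneg fun w => by positivity
  have := (hY'.sub_of_indepFun hX' hind.symm).measure_ge_le
    (ε := energyDistSq ν P Q / 2) (by positivity)
  refine (measureReal_mono fun d hd => ?_).trans (this.trans (Real.exp_le_exp.2 (le_of_eq ?_)))
  · rw [Set.mem_ofPred_eq] at hd
    have he := integral_witness_sub ν P Q
    simp only [Set.mem_ofPred_eq, hXd, hYd]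
    linarith
  · have h₁' : (n₁ : ℝ) ≠ 0 := by positivity
    have h₂' : (n₂ : ℝ) ≠ 0 := by positivity
    have h12 : (n₁ : ℝ) + n₂ ≠ 0 := by positivity
    push_cast
    field_simp
    ring

lemma isProbabilityMeasure_uniformOn_univ (n₁ n₂ : ℕ) :
    IsProbabilityMeasure (uniformOn (Set.univ : Set (PoolPerm n₁ n₂))) :=
  have : MeasurableSingletonClass (PoolPerm n₁ n₂) := ⟨fun _ => trivial⟩
  isProbabilityMeasure_uniformOn Set.finite_univ Set.univ_nonempty

/-- The type II error of the permutation test: the first term comes from the sample, the second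
from the Monte Carlo approximation of the permutation quantile. -/
theorem observationLaw_accept_le {n₁ n₂ B : ℕ} (h₁ : 1 ≤ n₁) (h₂ : 1 ≤ n₂) (hB : 1 ≤ B) {α t : ℝ}
    (hα : 0 ≤ α) (ν P Q : ProbabilityMeasure H) (ht : t ≤ energyDistSq ν P Q / 4)
    (hq : ∀ z : Fin n₁ ⊕ Fin n₂ → H, (uniformOn (Set.univ : Set (PoolPerm n₁ n₂))).real
      {π | t ≤ empEnergyDistSq ν (z ∘ π)} ≤ α / 2) :
    observationLaw n₁ n₂ B P Q (permutationTest n₁ n₂ B α ν)ᶜ ≤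
      ENNReal.ofReal
        (Real.exp (-(energyDistSq ν P Q) ^ 2 / (32 * ((n₁ : ℝ)⁻¹ + (n₂ : ℝ)⁻¹))) +
          Real.exp (-(B * α ^ 2 / 2))) := by
  have := isProbabilityMeasure_uniformOn_univ n₁ n₂
  have hsing : MeasurableSingletonClass (PoolPerm n₁ n₂) := ⟨fun _ => trivial⟩
  set μ := (Measure.pi fun _ : Fin n₁ => (P : Measure H)).prod
    (Measure.pi fun _ : Fin n₂ => (Q : Measure H)) with hμ
  set κ := Measure.pi fun _ : Fin B => uniformOn (Set.univ : Set (PoolPerm n₁ n₂)) with hκ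
  set bad : Set ((Fin n₁ → H) × (Fin n₂ → H)) :=
    {d | (n₁ : ℝ)⁻¹ * ∑ j, witness ν P Q (d.1 j) - (n₂ : ℝ)⁻¹ * ∑ k, witness ν P Q (d.2 k) ≤
        energyDistSq ν P Q / 2} with hbad
  set F : Observation H n₁ n₂ B → ℝ := fun o => ∑ b, Set.indicator {π : PoolPerm n₁ n₂ |
      t ≤ empEnergyDistSq ν (Sum.elim o.1.1 o.1.2 ∘ π)} (fun _ => (1 : ℝ)) (o.2 b) with hF
  have hFm : Measurable F := by
    refine measurable_from_prod_countable_left fun p => ?_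
    refine Finset.measurable_sum _ fun b _ => ?_
    exact measurable_const.indicator (s := {d : (Fin n₁ → H) × (Fin n₂ → H) |
      t ≤ empEnergyDistSq ν (Sum.elim d.1 d.2 ∘ p b)})
      (measurableSet_le measurable_const (measurable_empEnergyDistSq ν (p b)))
  set G : Set (Observation H n₁ n₂ B) := {o | B * α ≤ F o} with hG
  have hGm : MeasurableSet G := measurableSet_le measurable_const hFm
  -- Off `bad`, the observed statistic exceeds `D/2 - D/4 ≥ t`, with `D = energyDistSq ν P Q`, so
  -- acceptance forces `G`.
  have hsub : (permutationTest n₁ n₂ B α ν)ᶜ ⊆ bad ×ˢ Set.univ ∪ G := fun o ho => by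
    by_cases hd : o.1 ∈ bad
    · exact Or.inl ⟨hd, trivial⟩
    · refine Or.inr (accept_subset hB α t ν ho ?_)
      rw [hbad, Set.mem_ofPred_eq, not_le] at hd
      have := mean_witness_sub_le_empEnergyDistSq ν P Q (Sum.elim o.1.1 o.1.2)
      simp only [Sum.elim_inl, Sum.elim_inr] at this
      linarith
  have hbadle : μ bad ≤ ENNReal.ofReal
      (Real.exp (-(energyDistSq ν P Q) ^ 2 / (32 * ((n₁ : ℝ)⁻¹ + (n₂ : ℝ)⁻¹)))) := by
    rw [← ofReal_measureReal (measure_ne_top μ bad)]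
    exact ENNReal.ofReal_le_ofReal (mean_witness_sub_le_le h₁ h₂ ν P Q)
  have hGle : (μ.prod κ) G ≤ ENNReal.ofReal (Real.exp (-(B * α ^ 2 / 2))) := by
    -- Conditionally on the data, Hoeffding applies with success probability at most `α / 2` and
    -- excess `α / 2`; `hq` is uniform in the pooled sample.
    rw [Measure.prod_apply hGm]
    refine (lintegral_mono (g := fun _ => ENNReal.ofReal (Real.exp (-(B * α ^ 2 / 2))))
      fun d => ?_).trans (by simp)
    rw [← ofReal_measureReal (measure_ne_top κ _)]
    refine ENNReal.ofReal_le_ofReal ?_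
    have := pi_sum_indicator_ge_le (uniformOn (Set.univ : Set (PoolPerm n₁ n₂))) B
      (S := {π | t ≤ empEnergyDistSq ν (Sum.elim d.1 d.2 ∘ π)}) trivial
      (hq (Sum.elim d.1 d.2)) (ε := α / 2) (by positivity)
    rw [add_halves] at this
    refine this.trans (Real.exp_le_exp.2 (le_of_eq ?_))
    ring
  calc _ ≤ (μ.prod κ) (bad ×ˢ Set.univ ∪ G) := measure_mono hsub
    _ ≤ (μ.prod κ) (bad ×ˢ Set.univ) + (μ.prod κ) G := measure_union_le _ _
    _ ≤ _ := by
      rw [Measure.prod_prod, measure_univ, mul_one,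
        ENNReal.ofReal_add (Real.exp_nonneg _) (Real.exp_nonneg _)]
      exact add_le_add hbadle hGle

end EnergyTest

/-! ### Upper bound: choice of the constants -/

namespace EnergyTest

variable {H : Type*} [NormedAddCommGroup H] [InnerProductSpace ℝ H] [MeasurableSpace H]
  [BorelSpace H] [SecondCountableTopology H]

theorem separationRate_permutationTest_le {c₁ c₂ : ℝ} (hc₁ : 0 < c₁) (hc₂ : 0 < c₂)
    {n₁ n₂ B : ℕ} {α β : ℝ} (h₁ : 1 ≤ n₁) (h₂ : 1 ≤ n₂) (hr₁ : c₁ ≤ (n₁ : ℝ) / n₂)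
    (hr₂ : (n₁ : ℝ) / n₂ ≤ c₂) (hα : 0 < α) (hβ : 0 < β) (hαβ : α + β < 1)
    (hβe : β < (Real.exp 1)⁻¹) (hB : 2 * (α ^ 2)⁻¹ * Real.log (6 / β) ≤ B) :
    separationRate (fun ν : ProbabilityMeasure H => permutationTest n₁ n₂ B α ν) β ≤
      4 * (32 * (2 + c₁⁻¹ + c₂) ^ 2 + 3) * ((n₁ : ℝ) + n₂) ^ (-(1 / 2) : ℝ) *
        (Real.log α⁻¹ + Real.log β⁻¹) := by
  set K : ℝ := 2 + c₁⁻¹ + c₂ with hK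
  have hK2 : 2 ≤ K := by have := inv_pos.2 hc₁; linarith
  set c : ℝ := 4 * (32 * K ^ 2 + 3) with hc
  set n : ℝ := (n₁ : ℝ) + n₂ with hn
  set s : ℝ := Real.sqrt n with hs
  set l : ℝ := Real.log α⁻¹ + Real.log β⁻¹ with hl
  have hn₁ : (0 : ℝ) < n₁ := by positivity
  have hn₂ : (0 : ℝ) < n₂ := by positivity
  have hn0 : 0 < n := by positivity
  have hs0 : 0 < s := Real.sqrt_pos.2 hn0
  have hss : s ^ 2 = n := Real.sq_sqrt hn0.le
  have hrpow : n ^ (-(1 / 2) : ℝ) = s⁻¹ := by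
    rw [Real.rpow_neg hn0.le, ← Real.sqrt_eq_rpow]
  have hlα : 0 < Real.log α⁻¹ := Real.log_pos ((one_lt_inv₀ hα).2 (by linarith))
  have hlβ : 1 < Real.log β⁻¹ := by
    rw [Real.lt_log_iff_exp_lt (by positivity)]
    exact (lt_inv_comm₀ hβ (Real.exp_pos 1)).1 hβe
  have hl1 : 1 < l := by linarith
  have hc0 : 0 < c := by positivity
  -- The only use of the balance of the sample sizes: `n (1/n₁ + 1/n₂) = 2 + n₂/n₁ + n₁/n₂ ≤ K`.
  have hA : ((n₁ : ℝ)⁻¹ + (n₂ : ℝ)⁻¹) ≤ K / n := by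
    rw [le_div_iff₀ hn0]
    have e : ((n₁ : ℝ)⁻¹ + (n₂ : ℝ)⁻¹) * n = 2 + ((n₁ : ℝ) / n₂)⁻¹ + (n₁ : ℝ) / n₂ := by
      rw [hn]; field_simp; ring
    rw [e]
    have : ((n₁ : ℝ) / n₂)⁻¹ ≤ c₁⁻¹ := inv_anti₀ hc₁ hr₁
    linarith
  rw [hrpow]
  have hρ : 0 < c * s⁻¹ * l := by positivity
  have hlog2 : Real.log 2 < 1 := by linarith [Real.log_two_lt_d9]
  have hB0 : 1 ≤ B := by
    have h6 : 0 < Real.log (6 / β) :=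
      Real.log_pos (by rw [lt_div_iff₀ hβ]; linarith)
    have : (0 : ℝ) < B := lt_of_lt_of_le (by positivity) hB
    exact_mod_cast this
  refine csInf_le ⟨0, fun x hx => hx.1.le⟩ ⟨hρ, ?_⟩
  refine iSup₂_le fun ν _ => iSup₂_le fun p hp => ?_
  have hD : c * s⁻¹ * l ≤ energyDistSq ν p.1 p.2 := hp
  refine (observationLaw_accept_le (t := c * s⁻¹ * l / 4) h₁ h₂ hB0 hα.le ν p.1 p.2
    (by linarith) fun z => ?_).trans (ENNReal.ofReal_le_ofReal ?_)
  · refine (uniformOn_le_empEnergyDistSq_le h₁ h₂ ν z hs0.le _).trans ?_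
    have hexpo : 2 * ((n₁ : ℝ) + n₂) * (4 * s * ((n₁ : ℝ)⁻¹ + (n₂ : ℝ)⁻¹)) ^ 2 ≤ 32 * K ^ 2 := by
      calc _ ≤ 2 * n * (4 * s * (K / n)) ^ 2 := by gcongr
        _ = 32 * K ^ 2 * (s ^ 2 / n) := by field_simp; ring
        _ = _ := by rw [hss, div_self hn0.ne', mul_one]
    have hst : s * (c * s⁻¹ * l / 4) = (32 * K ^ 2 + 3) * l := by
      rw [hc]; field_simp
    rw [hst]
    have hfin : 2 * ((n₁ : ℝ) + n₂) * (4 * s * ((n₁ : ℝ)⁻¹ + (n₂ : ℝ)⁻¹)) ^ 2 -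
        (32 * K ^ 2 + 3) * l ≤ Real.log (α / 4) := by
      rw [Real.log_div hα.ne' (by norm_num), show (4 : ℝ) = 2 ^ 2 by norm_num, Real.log_pow]
      push_cast
      have : Real.log α = -Real.log α⁻¹ := by rw [Real.log_inv, neg_neg]
      rw [this]
      nlinarith [mul_nonneg (sq_nonneg K) (sub_nonneg.2 hl1.le)]
    have := (Real.exp_le_exp.2 hfin).trans_eq (Real.exp_log (by positivity))
    linarith
  · have hfirst : Real.exp (-(energyDistSq ν p.1 p.2) ^ 2 /
        (32 * ((n₁ : ℝ)⁻¹ + (n₂ : ℝ)⁻¹))) ≤ β / 2 := by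
      rw [← Real.exp_log (show 0 < β / 2 by positivity)]
      refine Real.exp_le_exp.2 ?_
      rw [Real.log_div hβ.ne' (by norm_num), neg_div, neg_le]
      have hlb : Real.log β = -Real.log β⁻¹ := by rw [Real.log_inv, neg_neg]
      have hKK : K * 2 ≤ K ^ 2 := by rw [sq]; gcongr
      have h64c : 64 * K ≤ c := by linarith
      have h64 : 64 * K ≤ c ^ 2 := h64c.trans (le_self_pow₀ (by linarith) two_ne_zero)
      calc -(Real.log β - Real.log 2) ≤ 2 * l := by rw [hlb]; linarith
        _ ≤ 2 * l ^ 2 := by gcongr; exact le_self_pow₀ hl1.le two_ne_zero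
        _ = 64 * K * (s⁻¹ ^ 2 * l ^ 2) / (32 * (K / n)) := by
            rw [inv_pow, hss]; field_simp; norm_num
        _ ≤ c ^ 2 * (s⁻¹ ^ 2 * l ^ 2) / (32 * (K / n)) := by gcongr
        _ = (c * s⁻¹ * l) ^ 2 / (32 * (K / n)) := by ring
        _ ≤ _ := by gcongr
    have hsecond : Real.exp (-(B * α ^ 2 / 2)) ≤ β / 6 := by
      rw [← Real.exp_log (show 0 < β / 6 by positivity)]
      refine Real.exp_le_exp.2 ?_
      have h6 : Real.log (β / 6) = -Real.log (6 / β) := by rw [← Real.log_inv, inv_div]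
      rw [h6, neg_le_neg_iff]
      calc Real.log (6 / β) = 2 * (α ^ 2)⁻¹ * Real.log (6 / β) * (α ^ 2 / 2) := by field_simp
        _ ≤ B * (α ^ 2 / 2) := by gcongr
        _ = _ := by ring
    linarith

end EnergyTest

/-! ### Lower bound: the least favourable laws and reference measures -/

namespace EnergyTest

section Reference

variable {H : Type*} [NormedAddCommGroup H] [MeasurableSpace H] [BorelSpace H]
  [TopologicalSpace.SeparableSpace H]

/-- There are reference measures with an atom of mass at least `1 / 4` at any prescribed point. -/
theorem exists_referenceMeasure_singleton (w : H) :
    ∃ ν ∈ referenceMeasures H, (1 / 4 : ℝ) ≤ (ν : Measure H).real {w} := by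
  -- Putting `w` before a dense sequence gives it weight at least `1/2` under `κ`; symmetrizing
  -- keeps at least half of that.
  set D : ℕ → H := fun k => Nat.casesOn k w (TopologicalSpace.denseSeq H) with hD
  set κ : Measure H := Measure.sum fun k : ℕ => (2⁻¹ : ℝ≥0∞) ^ (k + 1) • Measure.dirac (D k) with hκ
  have hκ1 : IsProbabilityMeasure κ := ⟨by
    simp [hκ, ENNReal.tsum_geometric_add_one, ENNReal.inv_mul_cancel]⟩
  have hκD : ∀ k (U : Set H), MeasurableSet U → D k ∈ U → (2⁻¹ : ℝ≥0∞) ^ (k + 1) ≤ κ U :=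
    fun k U hU hk => by
      rw [hκ, Measure.sum_apply _ hU]
      refine le_trans ?_ (ENNReal.le_tsum k)
      simp [Measure.dirac_apply' _ hU, hk]
  set ν : Measure H := (2⁻¹ : ℝ≥0∞) • κ + (2⁻¹ : ℝ≥0∞) • κ.map Neg.neg with hν
  have hνle : ∀ U, 2⁻¹ * κ U ≤ ν U := fun U => by simp [hν]
  have hν1 : IsProbabilityMeasure ν := ⟨by
    simp [hν, Measure.map_apply measurable_neg MeasurableSet.univ, ENNReal.inv_two_add_inv_two]⟩
  refine ⟨⟨ν, hν1⟩, ⟨fun A hA => ?_, ?_⟩, ?_⟩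
  · change ν (-A) = ν A
    simp [hν, Measure.map_apply measurable_neg hA, Measure.map_apply measurable_neg hA.neg, add_comm]
  · refine Set.eq_univ_of_forall fun x => Measure.mem_support_iff_forall x |>.2 fun U hU => ?_
    obtain ⟨y, hyU, k, rfl⟩ := (TopologicalSpace.denseRange_denseSeq H).inter_open_nonempty
      (interior U) isOpen_interior ⟨x, mem_interior_iff_mem_nhds.2 hU⟩
    have h1 := hκD (k + 1) (interior U) isOpen_interior.measurableSet hyU
    have h2 : 0 < 2⁻¹ * κ (interior U) := by
      refine ENNReal.mul_pos (by simp) (lt_of_lt_of_le ?_ h1).ne'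
      exact ENNReal.pow_pos (by simp) _
    exact h2.trans_le ((hνle _).trans (measure_mono interior_subset))
  · have h1 := hκD 0 {w} (measurableSet_singleton w) rfl
    have h2 : 2⁻¹ * 2⁻¹ ≤ ν {w} := le_trans (by rw [zero_add, pow_one] at h1; gcongr) (hνle {w})
    have h3 := ENNReal.toReal_mono (measure_ne_top ν {w}) h2
    rw [ENNReal.toReal_mul, ENNReal.toReal_inv, ENNReal.toReal_ofNat] at h3
    change _ ≤ (ν {w}).toReal
    linarith

end Reference

variable {H : Type*} [NormedAddCommGroup H] [InnerProductSpace ℝ H]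

/-- The infinite dimension of `H` enters here: the number of directions must outgrow any function of
`n₂` and `1 - α - β`. -/
lemma exists_orthonormal_fin (hH : ¬ FiniteDimensional ℝ H) (N : ℕ) :
    ∃ v : Fin N → H, Orthonormal ℝ v := by
  have hrank : (N : Cardinal) ≤ Module.rank ℝ H :=
    Cardinal.natCast_le_aleph0.trans (not_lt.1 fun h => hH (Module.rank_lt_aleph0_iff.1 h))
  obtain ⟨f, hf⟩ := exists_linearIndependent_of_le_rank hrank
  exact ⟨_, InnerProductSpace.gramSchmidtNormed_orthonormal hf⟩

/-- The law of a random sign. -/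
noncomputable def signLaw : Measure ℝ :=
  (2⁻¹ : ℝ≥0∞) • Measure.dirac 1 + (2⁻¹ : ℝ≥0∞) • Measure.dirac (-1)

instance : IsProbabilityMeasure signLaw := ⟨by simp [signLaw, ENNReal.inv_two_add_inv_two]⟩

lemma signLaw_singleton_one : signLaw {1} = 2⁻¹ := by
  have : (-1 : ℝ) ∉ ({1} : Set ℝ) := by norm_num
  simp [signLaw, this]

variable [MeasurableSpace H] [BorelSpace H] [SecondCountableTopology H]

/-- A law on `H` with a family of half-spaces that are pairwise independent events of probability
`1 / 2`, such that conditioning on any of them changes the characteristic functional by `1`. -/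
theorem exists_law_pairwise_indep (hH : ¬ FiniteDimensional ℝ H) (N : ℕ) :
    ∃ (P : ProbabilityMeasure H) (E : Fin N → Set H) (Q : Fin N → ProbabilityMeasure H)
      (w : Fin N → H),
      (∀ i, MeasurableSet (E i)) ∧ (∀ i, (P : Measure H) (E i) = 2⁻¹) ∧
      (∀ i j, i ≠ j → (P : Measure H) (E i ∩ E j) = 2⁻¹ * 2⁻¹) ∧
      (∀ i, (Q i : Measure H) = (2 : ℝ≥0∞) • (P : Measure H).restrict (E i)) ∧
      ∀ i, ‖charFun (P : Measure H) (w i) - charFun (Q i : Measure H) (w i)‖ = 1 := by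
  obtain ⟨v, hv⟩ := exists_orthonormal_fin hH N
  set μ : Measure (Fin N → ℝ) := Measure.pi fun _ => signLaw with hμ
  set X : (Fin N → ℝ) → H := fun e => ∑ i, e i • v i with hX
  have hXm : Measurable X := by
    have : Continuous X := by fun_prop
    exact this.measurable
  have hXv : ∀ e i, inner ℝ (X e) (v i) = e i := fun e i => by
    simpa using hv.inner_left_fintype e i
  set P : Measure H := μ.map X with hP
  have hP1 : IsProbabilityMeasure P := Measure.isProbabilityMeasure_map hXm.aemeasurable
  set E : Fin N → Set H := fun i => {x | inner ℝ x (v i) = 1} with hE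
  have hEm : ∀ i, MeasurableSet (E i) := fun i => by
    have : Continuous fun x : H => (inner ℝ x (v i) : ℝ) := by fun_prop
    exact this.measurable (measurableSet_singleton 1)
  have hXE : ∀ i, X ⁻¹' E i = (fun e : Fin N → ℝ => e i) ⁻¹' {1} := fun i => by
    ext e; simp [hE, hXv]
  have hPE : ∀ i, P (E i) = 2⁻¹ := fun i => by
    rw [hP, Measure.map_apply hXm (hEm i), hXE,
      (measurePreserving_eval (fun _ : Fin N => signLaw) i).measure_preimage
        (measurableSet_singleton 1).nullMeasurableSet, signLaw_singleton_one]
  have hind := iIndepFun_pi (μ := fun _ : Fin N => signLaw) (X := fun _ => id)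
    fun _ => aemeasurable_id
  have hPEE : ∀ i j, i ≠ j → P (E i ∩ E j) = 2⁻¹ * 2⁻¹ := fun i j hij => by
    rw [← hPE i]
    nth_rw 2 [hPE i]
    rw [← hPE j, hP, Measure.map_apply hXm ((hEm i).inter (hEm j)), Measure.map_apply hXm (hEm i),
      Measure.map_apply hXm (hEm j), Set.preimage_inter, hXE, hXE]
    exact (hind.indepFun hij).measure_inter_preimage_eq_mul _ _ (measurableSet_singleton 1)
      (measurableSet_singleton 1)
  have hQ1 : ∀ i, IsProbabilityMeasure ((2 : ℝ≥0∞) • P.restrict (E i)) := fun i => ⟨by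
    simp [hPE, ENNReal.mul_inv_cancel]⟩
  -- At this frequency the phase is `± π / 2`: averaging over the sign gives `0`, fixing it at `+1`
  -- gives `Complex.I`.
  refine ⟨⟨P, hP1⟩, E, fun i => ⟨_, hQ1 i⟩, fun i => (Real.pi / 2) • v i, hEm, hPE, hPEE,
    fun i => rfl, fun i => ?_⟩
  have hPφ : charFun P ((Real.pi / 2) • v i) = 0 := by
    have hmeas : Measurable fun r : ℝ => Complex.exp (((Real.pi / 2 * r : ℝ) : ℂ) * Complex.I) := by
      fun_prop
    calc charFun P ((Real.pi / 2) • v i)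
        = ∫ e, Complex.exp (((Real.pi / 2 * e i : ℝ) : ℂ) * Complex.I) ∂μ := by
          rw [charFun_apply, hP, integral_map hXm.aemeasurable (by fun_prop)]
          simp only [inner_smul_right, hXv]
      _ = ∫ r, Complex.exp (((Real.pi / 2 * r : ℝ) : ℂ) * Complex.I) ∂signLaw := by
          rw [← (measurePreserving_eval (fun _ : Fin N => signLaw) i).map_eq,
            integral_map (measurable_pi_apply i).aemeasurable hmeas.aestronglyMeasurable]
      _ = 0 := by
          have hi : ∀ a : ℝ, Integrable
              (fun r : ℝ => Complex.exp (((Real.pi / 2 * r : ℝ) : ℂ) * Complex.I))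
              ((2⁻¹ : ℝ≥0∞) • Measure.dirac a) := fun a =>
            (integrable_dirac (by simp)).smul_measure (by simp)
          rw [signLaw, integral_add_measure (hi 1) (hi (-1)), integral_smul_measure,
            integral_smul_measure, integral_dirac, integral_dirac]
          simp [Complex.exp_neg, Complex.exp_pi_div_two_mul_I]
  have hQφ : charFun ((2 : ℝ≥0∞) • P.restrict (E i)) ((Real.pi / 2) • v i) = Complex.I := by
    have := hQ1 i
    rw [charFun_apply]
    have hae : ∀ᵐ x ∂((2 : ℝ≥0∞) • P.restrict (E i)),
        Complex.exp (((inner ℝ x ((Real.pi / 2) • v i) : ℝ) : ℂ) * Complex.I) = Complex.I :=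
      Measure.ae_smul_measure ((ae_restrict_iff' (hEm i)).2 (ae_of_all _ fun x hx => by
        have hx' : inner ℝ x (v i) = (1 : ℝ) := hx
        rw [inner_smul_right, hx', mul_one]
        push_cast
        exact Complex.exp_pi_div_two_mul_I)) _
    rw [integral_congr_ae hae]
    simp
  change ‖charFun P _ - charFun ((2 : ℝ≥0∞) • P.restrict (E i)) _‖ = 1
  rw [hPφ, hQφ]
  simp

end EnergyTest

/-! ### Lower bound: pairwise independence defeats any single test -/

namespace EnergyTest

/-- An event cannot be negatively correlated with each of many pairwise independent events. -/
theorem exists_mul_sub_le_measureReal_inter {Ω : Type*} [MeasurableSpace Ω] (μ : Measure Ω)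
    [IsProbabilityMeasure μ] {N : ℕ} (hN : 1 ≤ N) {G : Fin N → Set Ω} {A : Set Ω} {p : ℝ}
    (hG : ∀ i, MeasurableSet (G i)) (hA : MeasurableSet A) (hp : ∀ i, μ.real (G i) = p)
    (hpp : ∀ i j, i ≠ j → μ.real (G i ∩ G j) = p ^ 2) :
    ∃ i, p * μ.real A - (Real.sqrt N)⁻¹ ≤ μ.real (A ∩ G i) := by
  have hN0 : (0 : ℝ) < N := by positivity
  have hs0 : 0 < Real.sqrt N := Real.sqrt_pos.2 hN0
  have hss : Real.sqrt N * Real.sqrt N = N := Real.mul_self_sqrt hN0.le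
  have : Nonempty (Fin N) := ⟨⟨0, hN⟩⟩
  set f : Fin N → Ω → ℝ := fun i => (G i).indicator 1 with hf
  set a : Ω → ℝ := A.indicator 1 with ha
  have hfi : ∀ i, Integrable (f i) μ := fun i => (integrable_const 1).indicator (hG i)
  have hai : Integrable a μ := (integrable_const 1).indicator hA
  have hff : ∀ i j, (fun ω => f i ω * f j ω) = (G i ∩ G j).indicator 1 := fun i j => by
    ext ω; simp [hf, Set.inter_indicator_one]
  have haf : ∀ i, (fun ω => a ω * f i ω) = (A ∩ G i).indicator 1 := fun i => by
    ext ω; simp [hf, ha, Set.inter_indicator_one]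
  have hffi : ∀ i j, Integrable (fun ω => f i ω * f j ω) μ := fun i j => by
    rw [hff]; exact (integrable_const 1).indicator ((hG i).inter (hG j))
  have hafi : ∀ i, Integrable (fun ω => a ω * f i ω) μ := fun i => by
    rw [haf]; exact (integrable_const 1).indicator (hA.inter (hG i))
  have hIf : ∀ i, ∫ ω, f i ω ∂μ = p := fun i => by
    rw [← hp i]; exact integral_indicator_one (hG i)
  have hcov : ∀ i j, (fun ω => (f i ω - p) * (f j ω - p)) =
      fun ω => f i ω * f j ω - p * f i ω - p * f j ω + p ^ 2 := fun i j => by ext ω; ring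
  have hcovi : ∀ i j, Integrable (fun ω => (f i ω - p) * (f j ω - p)) μ := fun i j => by
    rw [hcov]
    exact (((hffi i j).sub ((hfi i).const_mul p)).sub ((hfi j).const_mul p)).add
      (integrable_const _)
  have hcov' : ∀ i j, ∫ ω, (f i ω - p) * (f j ω - p) ∂μ = μ.real (G i ∩ G j) - p ^ 2 := by
    intro i j
    have h1 : Integrable (fun ω => f i ω * f j ω - p * f i ω) μ :=
      (hffi i j).sub ((hfi i).const_mul p)
    have h2 : Integrable (fun ω => f i ω * f j ω - p * f i ω - p * f j ω) μ :=
      h1.sub ((hfi j).const_mul p)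
    rw [hcov, integral_add h2 (integrable_const _), integral_sub h1 ((hfi j).const_mul p), integral_sub (hffi i j) ((hfi i).const_mul p), integral_const_mul,
      integral_const_mul, hIf, hIf, hff, integral_indicator_one ((hG i).inter (hG j))]
    simp
    ring
  -- Pairwise independence kills the off-diagonal covariances, and each variance is at most `1`.
  have hvar : ∫ ω, (∑ i, (f i ω - p)) ^ 2 ∂μ ≤ N := by
    simp only [sq, Finset.sum_mul_sum]
    rw [integral_finsetSum _ fun i _ => integrable_finsetSum _ fun j _ => hcovi i j]
    simp only [integral_finsetSum _ fun j _ => hcovi _ j, hcov']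
    calc _ ≤ ∑ i : Fin N, ∑ j : Fin N, (if i = j then (1 : ℝ) else 0) :=
          Finset.sum_le_sum fun i _ => Finset.sum_le_sum fun j _ => by
            split_ifs with h
            · linarith [measureReal_le_one (μ := μ) (s := G i ∩ G j), sq_nonneg p]
            · rw [hpp i j h, sub_self]
      _ = N := by simp
  have hvari : Integrable (fun ω => (∑ i, (f i ω - p)) ^ 2) μ := by
    simp only [sq, Finset.sum_mul_sum]
    exact integrable_finsetSum _ fun i _ => integrable_finsetSum _ fun j _ => hcovi i j
  have hafp : ∀ i, Integrable (fun ω => a ω * f i ω - p * a ω) μ := fun i =>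
    (hafi i).sub (hai.const_mul p)
  -- By AM-GM, `a y ≥ -(√N / 2 + y² / (2 √N))` for `a ∈ {0, 1}`. With the variance bound, the
  -- covariances with `A` sum to at least `-√N`, so one of the `N` is at least `-1 / √N`.
  have hmain : ∫ ω, -(Real.sqrt N / 2 + (∑ i, (f i ω - p)) ^ 2 / (2 * Real.sqrt N)) ∂μ ≤
      ∫ ω, ∑ i, (a ω * f i ω - p * a ω) ∂μ := by
    refine integral_mono ((integrable_const _).add (hvari.div_const _)).neg
      (integrable_finsetSum _ fun i _ => hafp i) fun ω => ?_
    have hsum : ∑ i, (a ω * f i ω - p * a ω) = a ω * ∑ i, (f i ω - p) := by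
      rw [Finset.mul_sum]; exact Finset.sum_congr rfl fun i _ => by ring
    simp only
    rw [hsum]
    set y := ∑ i, (f i ω - p)
    have hy : 0 ≤ Real.sqrt N / 2 + y + y ^ 2 / (2 * Real.sqrt N) := by
      have : Real.sqrt N / 2 + y + y ^ 2 / (2 * Real.sqrt N) =
          (Real.sqrt N + y) ^ 2 / (2 * Real.sqrt N) := by field_simp; ring
      rw [this]; positivity
    by_cases hω : ω ∈ A
    · simp only [ha, Set.indicator_of_mem hω, Pi.one_apply]; linarith
    · simp only [ha, Set.indicator_of_notMem hω, zero_mul]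
      rw [neg_nonpos]; positivity
  have hleft : -Real.sqrt N ≤
      ∫ ω, -(Real.sqrt N / 2 + (∑ i, (f i ω - p)) ^ 2 / (2 * Real.sqrt N)) ∂μ := by
    rw [integral_neg, integral_add (integrable_const _) (hvari.div_const _)]
    simp only [integral_div, integral_const, probReal_univ, one_smul, neg_le_neg_iff]
    have : (∫ ω, (∑ i, (f i ω - p)) ^ 2 ∂μ) / (2 * Real.sqrt N) ≤ Real.sqrt N / 2 := by
      rw [div_le_iff₀ (by positivity)]
      linarith
    linarith
  have hright : ∫ ω, ∑ i, (a ω * f i ω - p * a ω) ∂μ = ∑ i, (μ.real (A ∩ G i) - p * μ.real A) := by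
    rw [integral_finsetSum _ fun i _ => hafp i]
    refine Finset.sum_congr rfl fun i _ => ?_
    rw [integral_sub (hafi i) (hai.const_mul p), haf, integral_const_mul,
      integral_indicator_one (hA.inter (hG i)), integral_indicator_one hA]
  by_contra! hcon
  have hlt : ∑ i, (μ.real (A ∩ G i) - p * μ.real A) < ∑ _i : Fin N, -(Real.sqrt N)⁻¹ :=
    Finset.sum_lt_sum_of_nonempty Finset.univ_nonempty fun i _ => by linarith [hcon i]
  have hN' : ∑ _i : Fin N, -(Real.sqrt N)⁻¹ = -Real.sqrt N := by
    simp only [Finset.sum_const, Finset.card_univ, Fintype.card_fin, nsmul_eq_mul]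
    nth_rw 1 [← hss]
    field_simp
  linarith

section ObservationLaw

/-- The event that every point of the second sample lies in `E`. -/
def secondSampleIn {H : Type*} (n₁ n₂ B : ℕ) (E : Set H) : Set (Observation H n₁ n₂ B) :=
  (Set.univ ×ˢ Set.univ.pi fun _ : Fin n₂ => E) ×ˢ Set.univ

lemma secondSampleIn_inter {H : Type*} (n₁ n₂ B : ℕ) (E F : Set H) :
    secondSampleIn n₁ n₂ B E ∩ secondSampleIn n₁ n₂ B F = secondSampleIn n₁ n₂ B (E ∩ F) := by
  rw [secondSampleIn, secondSampleIn, secondSampleIn, Set.prod_inter_prod, Set.prod_inter_prod,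
    Set.univ_inter, Set.univ_inter, Set.pi_inter_distrib]

variable {H : Type*} [MeasurableSpace H]

instance (n₁ n₂ B : ℕ) (P Q : ProbabilityMeasure H) :
    IsProbabilityMeasure (observationLaw n₁ n₂ B P Q) := by
  have := isProbabilityMeasure_uniformOn_univ n₁ n₂
  unfold observationLaw
  infer_instance

lemma measurableSet_secondSampleIn (n₁ n₂ B : ℕ) {E : Set H} (hE : MeasurableSet E) :
    MeasurableSet (secondSampleIn n₁ n₂ B E) :=
  (MeasurableSet.univ.prod (MeasurableSet.univ_pi fun _ => hE)).prod MeasurableSet.univ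

lemma observationLaw_secondSampleIn (n₁ n₂ B : ℕ) (P Q : ProbabilityMeasure H) (E : Set H) :
    observationLaw n₁ n₂ B P Q (secondSampleIn n₁ n₂ B E) = (Q : Measure H) E ^ n₂ := by
  have := isProbabilityMeasure_uniformOn_univ n₁ n₂
  rw [observationLaw, secondSampleIn, Measure.prod_prod, Measure.prod_prod, Measure.pi_pi]
  simp

lemma pi_smul_measure {Ω : Type*} [MeasurableSpace Ω] (μ : Measure Ω) [IsFiniteMeasure μ]
    {c : ℝ≥0∞} (hc : c ≠ ∞) (n : ℕ) :
    (Measure.pi fun _ : Fin n => c • μ) = c ^ n • Measure.pi fun _ : Fin n => μ := by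
  have : IsFiniteMeasure (c • μ) := μ.smul_finite hc
  refine Measure.pi_eq fun s _ => ?_
  rw [Measure.smul_apply, Measure.pi_pi]
  simp [Finset.prod_mul_distrib]

/-- Restricting the law of the second sample to `E` and renormalizing restricts the law of the
observation. -/
lemma observationLaw_smul_restrict {n₁ n₂ B : ℕ} {P Q : ProbabilityMeasure H} {E : Set H}
    {c : ℝ≥0∞} (hc : c ≠ ∞) (hQ : (Q : Measure H) = c • (P : Measure H).restrict E)
    {A : Set (Observation H n₁ n₂ B)} (hA : MeasurableSet A) :
    observationLaw n₁ n₂ B P Q A =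
      c ^ n₂ * observationLaw n₁ n₂ B P P (A ∩ secondSampleIn n₁ n₂ B E) := by
  have := isProbabilityMeasure_uniformOn_univ n₁ n₂
  have hfin : c ^ n₂ ≠ ∞ := ENNReal.pow_ne_top hc
  rw [← Measure.restrict_apply hA]
  simp only [observationLaw, secondSampleIn, hQ]
  rw [pi_smul_measure _ hc, ← Measure.restrict_prod_eq_prod_univ, ← Measure.prod_restrict,
    Measure.restrict_univ, Measure.restrict_pi_pi, Measure.prod_smul_right,
    Measure.prod_smul_left, Measure.smul_apply, smul_eq_mul]

end ObservationLaw

variable {H : Type*} [NormedAddCommGroup H] [InnerProductSpace ℝ H] [MeasurableSpace H]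
  [BorelSpace H] [SecondCountableTopology H]

/-- Every test of level `α` has type II error at least `β` at some pair of laws whose squared energy
distance, for some reference measure, is at least `1 / 4`. -/
theorem exists_lt_observationLaw_compl (hH : ¬ FiniteDimensional ℝ H) {n₁ n₂ B : ℕ} {α β : ℝ}
    (hα : 0 < α) (hβ : 0 < β) (hαβ : α + β < 1) {ψ : Set (Observation H n₁ n₂ B)}
    (hψ : ψ ∈ levelTests H n₁ n₂ B α) :
    ∃ ν ∈ referenceMeasures H, ∃ P Q : ProbabilityMeasure H, 1 / 4 ≤ energyDistSq ν P Q ∧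
      ENNReal.ofReal β < observationLaw n₁ n₂ B P Q ψᶜ := by
  have hgap : 0 < 1 - α - β := by linarith
  -- Conditioning on an event of probability `2^(-n₂)` magnifies the error `1 / √N` by `2 ^ n₂`; it
  -- must stay below the gap `1 - α - β`.
  obtain ⟨N₀, hN₀⟩ := exists_nat_gt ((2 ^ n₂ / (1 - α - β)) ^ 2)
  set N := N₀ + 1 with hN
  have hNlt : 2 ^ n₂ * (Real.sqrt N)⁻¹ < 1 - α - β := by
    have hs : 2 ^ n₂ / (1 - α - β) < Real.sqrt N := by
      refine Real.lt_sqrt_of_sq_lt (hN₀.trans ?_)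
      rw [hN]; push_cast; linarith
    have hs0 : 0 < Real.sqrt N := lt_of_le_of_lt (by positivity) hs
    rw [div_lt_iff₀ hgap] at hs
    rw [← div_eq_mul_inv, div_lt_iff₀ hs0]
    linarith
  obtain ⟨P, E, Q, w, hEm, hPE, hPEE, hQ, hw⟩ := exists_law_pairwise_indep hH N
  set μ := observationLaw n₁ n₂ B P P with hμ
  have hA : MeasurableSet ψᶜ := hψ.1.compl
  have hlevel : 1 - α ≤ μ.real ψᶜ := by
    have h1 : μ ψ ≤ ENNReal.ofReal α := (le_iSup (fun P : ProbabilityMeasure H =>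
      observationLaw n₁ n₂ B P P ψ) P).trans hψ.2
    have h2 : μ.real ψ ≤ α := ENNReal.toReal_le_of_le_ofReal hα.le h1
    rw [probReal_compl_eq_one_sub hψ.1]
    linarith
  obtain ⟨i, hi⟩ := exists_mul_sub_le_measureReal_inter μ (N := N) (by omega)
    (G := fun i => secondSampleIn n₁ n₂ B (E i)) (A := ψᶜ) (p := (2⁻¹ : ℝ) ^ n₂)
    (fun i => measurableSet_secondSampleIn n₁ n₂ B (hEm i)) hA
    (fun i => by
      rw [Measure.real, hμ, observationLaw_secondSampleIn, hPE]; simp)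
    (fun i j hij => by
      rw [secondSampleIn_inter, Measure.real, hμ, observationLaw_secondSampleIn, hPEE i j hij]
      simp [mul_pow, sq])
  -- The reference measure is chosen after the test, with its atom where `P` and `Q i` are told
  -- apart.
  obtain ⟨ν, hν, hνw⟩ := exists_referenceMeasure_singleton (w i)
  refine ⟨ν, hν, P, Q i, ?_, ?_⟩
  · have hgm : Measurable fun x => ‖charFun (P : Measure H) x - charFun (Q i : Measure H) x‖ ^ 2 :=
      (measurable_charFun.sub measurable_charFun).norm.pow_const 2
    have hgi : Integrable (fun x => ‖charFun (P : Measure H) x - charFun (Q i : Measure H) x‖ ^ 2)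
        (ν : Measure H) :=
      Integrable.of_bound hgm.aestronglyMeasurable 4 (ae_of_all _ fun x => by
        rw [Real.norm_of_nonneg (by positivity)]
        nlinarith [norm_charFun_sub_le_two P (Q i) x,
          norm_nonneg (charFun (P : Measure H) x - charFun (Q i : Measure H) x)])
    calc (1 / 4 : ℝ) ≤ (ν : Measure H).real {w i} := hνw
      _ = ∫ x in {w i}, ‖charFun (P : Measure H) x - charFun (Q i : Measure H) x‖ ^ 2
          ∂(ν : Measure H) := by rw [integral_singleton, hw i]; simp
      _ ≤ _ := setIntegral_le_integral hgi (ae_of_all _ fun x => by positivity)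
  · have hobs := observationLaw_smul_restrict (n₁ := n₁) (n₂ := n₂) (B := B)
      (by simp : (2 : ℝ≥0∞) ≠ ∞) (hQ i) hA
    have hreal : (observationLaw n₁ n₂ B P (Q i)).real ψᶜ =
        2 ^ n₂ * μ.real (ψᶜ ∩ secondSampleIn n₁ n₂ B (E i)) := by
      rw [Measure.real, hobs]; simp [Measure.real, hμ]
    rw [← ofReal_measureReal (measure_ne_top _ _), ENNReal.ofReal_lt_ofReal_iff_of_nonneg hβ.le,
      hreal]
    have h2 := mul_le_mul_of_nonneg_left hi (show (0 : ℝ) ≤ 2 ^ n₂ by positivity)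
    rw [mul_sub, ← mul_assoc, ← mul_pow, mul_inv_cancel₀ two_ne_zero, one_pow, one_mul] at h2
    linarith

theorem le_minimaxRate (hH : ¬ FiniteDimensional ℝ H) {n₁ n₂ : ℕ} (B : ℕ) {α β : ℝ}
    (hα : 0 < α) (hβ : 0 < β) (hαβ : α + β < 1) :
    1 / 4 ≤ minimaxRate H n₁ n₂ B α β := by
  -- Both infima need a nonempty set, as `sInf ∅ = 0` in `ℝ`. The test that never rejects has level
  -- `α`; at `ρ = 5` there are no alternatives, since the squared distance is at most `4`.
  refine le_csInf ⟨_, ∅, ⟨MeasurableSet.empty, by simp⟩, rfl⟩ ?_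
  rintro _ ⟨ψ, hψ, rfl⟩
  refine le_csInf ⟨5, by norm_num, ?_⟩ fun ρ hρ => ?_
  · refine iSup₂_le fun ν _ => iSup₂_le fun p hp => ?_
    have h5 : 5 ≤ energyDistSq ν p.1 p.2 := hp
    have : energyDistSq ν p.1 p.2 ≤ ∫ _w : H, (4 : ℝ) ∂(ν : Measure H) := by
      refine integral_mono_of_nonneg (ae_of_all _ fun w => by positivity) (integrable_const _)
        (ae_of_all _ fun w => ?_)
      simp only
      nlinarith [norm_charFun_sub_le_two p.1 p.2 w,
        norm_nonneg (charFun (p.1 : Measure H) w - charFun (p.2 : Measure H) w)]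
    simp only [integral_const, probReal_univ, one_smul] at this
    linarith
  · by_contra! hlt
    obtain ⟨ν, hν, P, Q, hD, hlow⟩ := exists_lt_observationLaw_compl hH hα hβ hαβ hψ
    refine absurd (le_trans ?_ hρ.2) (not_le.2 hlow)
    refine le_trans ?_ (le_iSup₂ (f := fun (ν : ProbabilityMeasure H)
      (_ : ν ∈ referenceMeasures H) => ⨆ p ∈ localAlternatives ν ρ,
      observationLaw n₁ n₂ B p.1 p.2 ψᶜ) ν hν)
    exact le_iSup₂ (f := fun (p : ProbabilityMeasure H × ProbabilityMeasure H)
      (_ : p ∈ localAlternatives ν ρ) => observationLaw n₁ n₂ B p.1 p.2 ψᶜ) (P, Q)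
      (hlt.le.trans hD)

end EnergyTest

theorem mainTheorem5 {H : Type*} [NormedAddCommGroup H] [InnerProductSpace ℝ H] [CompleteSpace H]
    [TopologicalSpace.SeparableSpace H] [MeasurableSpace H] [BorelSpace H]
    (hH : ¬ FiniteDimensional ℝ H) :
    (∀ c₁ c₂ : ℝ, 0 < c₁ → 0 < c₂ → ∃ c : ℝ, 0 < c ∧
      ∀ (n₁ n₂ B : ℕ) (α β : ℝ), 1 ≤ n₁ → 1 ≤ n₂ →
        c₁ ≤ (n₁ : ℝ) / n₂ → (n₁ : ℝ) / n₂ ≤ c₂ →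
        0 < α → 0 < β → α + β < 1 → β < (Real.exp 1)⁻¹ →
        2 * (α ^ 2)⁻¹ * Real.log (6 / β) ≤ B →
        EnergyTest.separationRate
            (fun ν : ProbabilityMeasure H => EnergyTest.permutationTest n₁ n₂ B α ν) β ≤
          c * ((n₁ : ℝ) + n₂) ^ (-(1 / 2) : ℝ) * (Real.log α⁻¹ + Real.log β⁻¹)) ∧
    (∃ c' : ℝ, 0 < c' ∧
      ∀ (n₁ n₂ B : ℕ) (α β : ℝ), 1 ≤ n₁ → 1 ≤ n₂ → 0 < α → 0 < β → α + β < 1 →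
        c' * ((n₁ : ℝ) + n₂) ^ (-(1 / 2) : ℝ) ≤ EnergyTest.minimaxRate H n₁ n₂ B α β) := by
  have : SecondCountableTopology H := UniformSpace.secondCountable_of_separable H
  refine ⟨fun c₁ c₂ hc₁ hc₂ => ⟨4 * (32 * (2 + c₁⁻¹ + c₂) ^ 2 + 3), by positivity, ?_⟩,
    1 / 4, by norm_num, ?_⟩
  · intro n₁ n₂ B α β h₁ h₂ hr₁ hr₂ hα hβ hαβ hβe hB
    exact EnergyTest.separationRate_permutationTest_le hc₁ hc₂ h₁ h₂ hr₁ hr₂ hα hβ hαβ hβe hB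
  · intro n₁ n₂ B α β h₁ h₂ hα hβ hαβ
    have hn : (1 : ℝ) ≤ (n₁ : ℝ) + n₂ := by
      have : (1 : ℝ) ≤ n₁ := by exact_mod_cast h₁
      have : (0 : ℝ) ≤ n₂ := by positivity
      linarith
    -- The constant bound `1 / 4` is stronger than the stated rate.
    have hpow : ((n₁ : ℝ) + n₂) ^ (-(1 / 2) : ℝ) ≤ 1 :=
      Real.rpow_le_one_of_one_le_of_nonpos hn (by norm_num)
    linarith [EnergyTest.le_minimaxRate hH (n₁ := n₁) (n₂ := n₂) B hα hβ hαβ]
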